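/- **Conventions.** Let $\mathbb R^{n_1\times n_2\times n_3}$ carry the Frobenius inner product and norm. For a tensor $T$ of size $a\times b\times c$ let $T^{\mathrm L}\in\mathbb R^{a\times bc}$ and $T^{\mathrm R}\in\mathbb R^{ab\times c}$ be its left and right unfoldings, let $[M]$ denote the tensor with a given unfolding $M$, and let $M\cdot T$, $T\cdot M$ be the contractions of a matrix with the first, respectively last, mode of $T$. $\mathrm{St}(p,n)=\{U\in\mathbb R^{n\times p}: U^\top U=I_p\}$, $P_U=UU^\top$, $P_U^\perp=I-UU^\top$. A tensor-train decomposition (TTD) of $X$ of size $(q_1,q_2)$ is a factorization $X=X_1\cdot X_2\cdot X_3$ with $X_1\in\mathbb R^{n_1\times q_1}$, $X_2\in\mathbb R^{q_1\times n_2\times q_2}$, $X_3\in\mathbb R^{q_2\times n_3}$; the TT-rank of $X$ is the (entrywise) minimal $(q_1,q_2)$ for which a TTD exists. $\mathbb R^{n_1\times n_2\times n_3}_{\le(k_1,k_2)}$ is the set of tensors of TT-rank $\le(k_1,k_2)$ entrywise, and $T_X$ denotes its (Bouligand) tangent cone at $X$. For $Y\in\mathbb R^{n_1\times n_2\times n_3}$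 let $\mathcal P_{T_X}Y=\operatorname{argmin}_{Z\in T_X}\|Z-Y\|^2$. "$[U,S,V]\gets\mathrm{SVD}_s(A)$" means that $USV^\top$ is a truncated SVD of rank $s$ of $A$ (the first $s$ singular triplets, with decreasing and possibly zero singular values, of some SVD of $A$). **Setting.** Let $k_1\le n_1$, $k_2\le n_3$, let $X$ have TT-rank $(r_1,r_2)\le(k_1,k_2)$ with $(r_1,r_2)\ne(k_1,k_2)$, put $s_i=k_i-r_i$, and let $$X=X_1\cdot X_2''\cdot X_3''=X_1'\cdot X_2'\cdot X_3$$ be TTDs of size $(r_1,r_2)$ with $(X_2''^{\mathrm L})^\top\in\mathrm{St}(r_1,n_2r_2)$, $X_3''^\top\in\mathrm{St}(r_2,n_3)$, $X_1'\in\mathrm{St}(r_1,n_1)$, $X_2'^{\mathrm R}\in\mathrm{St}(r_2,r_1n_2)$. Fractions $0/0$ below are read as $0$. **Closed formulas.** For $U_1\in\mathrm{St}(s_1,n_1)$ and $V_3^\top\in\mathrm{St}(s_2,n_3)$ with $U_1^\top X_1'=0$ and $V_3X_3''^\top=0$ put $$W_1=P_{X_1'}^\perp(Y\cdot X_3''^\top)^{\mathrm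 L}(X_2''^{\mathrm L})^\top,\quad W_3=(X_2'^{\mathrm R})^\top(X_1'^\top\cdot Y)^{\mathrm R}P_{X_3''^\top}^\perp,\quad W_2=X_1'^\top\cdot Y\cdot X_3''^\top,$$ $$U_2=\big[P_{X_2'^{\mathrm R}}^\perp(X_1'^\top\cdot Y)^{\mathrm R}\big]\cdot V_3^\top,\quad V_2=U_1^\top\cdot\big[(Y\cdot X_3''^\top)^{\mathrm L}P_{(X_2''^{\mathrm L})^\top}^\perp\big],\quad Z_2=U_1^\top\cdot Y\cdot V_3^\top,$$ $$Y_\parallel(U_1,V_3)=W_1\cdot X_2''\cdot X_3''+X_1'\cdot X_2'\cdot W_3+X_1'\cdot W_2\cdot X_3''+U_1\cdot V_2\cdot X_3''+X_1'\cdot U_2\cdot V_3+U_1\cdot Z_2\cdot V_3 .$$ **Algorithm.** Given $\varepsilon>0$ and an integer $i_{\max}\ge1$, define for matrices $V_3$ with $n_3$ columns and $U_1$ with $n_1$ rows $$A(V_3)=P_{X_1'}^\perp\Big((Y\cdot P_{V_3^\top})^{\mathrm L}+C\Big),\qquad C=(Y\cdot X_3''^\top)^{\mathrm L}P^\perp_{(X_2''^{\mathrm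 L})^\top}(X_3''\otimes I_{n_2}),$$ $$B(U_1)=\Big((P_{U_1}\cdot Y)^{\mathrm R}+D\Big)P_{X_3''^\top}^\perp,\qquad D=(I_{n_2}\otimes X_1')P^\perp_{X_2'^{\mathrm R}}(X_1'^\top\cdot Y)^{\mathrm R}.$$ Initialize $i\gets0$, $V_3\gets P_{X_3''^\top}^\perp$, $U_1\gets P_{X_1'}^\perp$, $\eta_1\gets0$, $\eta_{\mathrm{new}}\gets\infty$. While $i<i_{\max}$ and $|\eta_{\mathrm{new}}-\eta_1|>\varepsilon$, do: $\eta_1\gets\eta_{\mathrm{new}}$, $i\gets i+1$, and * if $s_2/(n_3-r_2)>s_1/(n_1-r_1)$: $[U_1,\sim,\sim]\gets\mathrm{SVD}_{s_1}(A(V_3))$, then $[\sim,S,V_3^\top]\gets\mathrm{SVD}_{s_2}(B(U_1))$, then $\eta_{\mathrm{new}}\gets\|S\|^2+\|P_{U_1}C\|^2$; * otherwise: $[\sim,\sim,V_3^\top]\gets\mathrm{SVD}_{s_2}(B(U_1))$, then $[U_1,S,\sim]\gets\mathrm{SVD}_{s_1}(A(V_3))$, then $\eta_{\mathrm{new}}\gets\|S\|^2+\|D\,P_{V_3^\top}\|^2$.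 In every SVD the singular vectors kept are chosen so that $U_1^\top X_1'=0$, respectively $V_3X_3''^\top=0$ (this is automatic unless the matrix has rank less than $s_1$, respectively $s_2$). Output $(U_1,V_3)$. Since truncated SVDs need not be unique, several outputs are possible; let $\tilde{\mathcal P}_{T_X}Y$ be the set of all $Y_\parallel(U_1,V_3)$ with $(U_1,V_3)$ a possible output. **Theorem.** Let $$\omega=\sqrt{\max\Big\{\frac{k_1-r_1}{n_1-r_1},\frac{k_2-r_2}{n_3-r_2}\Big\}} .$$ For all $\varepsilon>0$ and all $i_{\max}\ge1$, $\tilde{\mathcal P}_{T_X}$ is an approximate projection onto $T_X$ with constant $\omega$. That is, $\omega\in(0,1]$, and for every $Y\in\mathbb R^{n_1\times n_2\times n_3}$: $\mathcal P_{T_X}Y\neq\emptyset$; $\tilde{\mathcal P}_{T_X}Y\ne\emptyset$ if $s_1\le n_2n_3$ and $s_2\le n_1n_2$ (so that the truncated SVDs exist); and for every $\tilde Y\in\tilde{\mathcal P}_{T_X}Y$ one has $\tilde Y\in T_X$ and $$\langle Y,\tilde Y\rangle\ \ge\ \omega\,\|\hat Y\|\,\|\tilde Y\|\qquad\text{for every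 }\hat Y\in\mathcal P_{T_X}Y .$$ -/

import Mathlib

open scoped NNReal ENNReal Matrix

noncomputable section

namespace TTCone

/-! ## Third-order tensors, contractions, unfoldings -/

/-- Real third-order tensors with the Frobenius inner product and norm. -/
abbrev Tensor (a b c : ℕ) : Type := EuclideanSpace ℝ (Fin a × Fin b × Fin c)

/-- Contraction `M · T` of a matrix with a tensor along the first mode. -/
def lmul {p a b c : ℕ} (M : Matrix (Fin p) (Fin a) ℝ) (T : Tensor a b c) : Tensor p b c :=
  WithLp.toLp 2 fun x => ∑ i, M x.1 i * T (i, x.2.1, x.2.2)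

/-- Contraction `T · M` of a tensor with a matrix along the third mode. -/
def rmul {a b c q : ℕ} (T : Tensor a b c) (M : Matrix (Fin c) (Fin q) ℝ) : Tensor a b q :=
  WithLp.toLp 2 fun x => ∑ l, T (x.1, x.2.1, l) * M l x.2.2

/-- Left unfolding `T^L` (its columns are indexed by pairs). -/
def lUnf {a b c : ℕ} (T : Tensor a b c) : Matrix (Fin a) (Fin b × Fin c) ℝ :=
  Matrix.of fun i x => T (i, x.1, x.2)

/-- Right unfolding `T^R` (its rows are indexed by pairs). -/
def rUnf {a b c : ℕ} (T : Tensor a b c) : Matrix (Fin a × Fin b) (Fin c) ℝ :=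
  Matrix.of fun x l => T (x.1, x.2, l)

/-- The tensor with a given left unfolding. -/
def lFold {a b c : ℕ} (M : Matrix (Fin a) (Fin b × Fin c) ℝ) : Tensor a b c :=
  WithLp.toLp 2 fun x => M x.1 (x.2.1, x.2.2)

/-- The tensor with a given right unfolding. -/
def rFold {a b c : ℕ} (M : Matrix (Fin a × Fin b) (Fin c) ℝ) : Tensor a b c :=
  WithLp.toLp 2 fun x => M (x.1, x.2.1) x.2.2

/-! ## Stiefel matrices, projectors, truncated SVDs -/

/-- `U` has orthonormal columns, i.e. `Uᵀ U = I`. -/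
def IsStiefel {ι : Type*} [Fintype ι] {p : ℕ} (U : Matrix ι (Fin p) ℝ) : Prop :=
  Uᵀ * U = 1

/-- `P_U = U Uᵀ`. -/
def proj {ι κ : Type*} [Fintype κ] (U : Matrix ι κ ℝ) : Matrix ι ι ℝ := U * Uᵀ

/-- `P_U^⊥ = I - U Uᵀ`. -/
def perp {ι κ : Type*} [DecidableEq ι] [Fintype κ] (U : Matrix ι κ ℝ) : Matrix ι ι ℝ :=
  1 - U * Uᵀ

/-- Squared Frobenius norm of a matrix. -/
def frobSq {ι κ : Type*} [Fintype ι] [Fintype κ] (M : Matrix ι κ ℝ) : ℝ :=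
  ∑ i, ∑ j, M i j ^ 2

/-- `A = U diag(σ) Vᵀ` is a singular value decomposition with `p` singular triplets (zero
singular values are allowed), the singular values being listed in decreasing order. -/
structure IsSVD {ι κ : Type*} [Fintype ι] [Fintype κ] {p : ℕ} (A : Matrix ι κ ℝ)
    (U : Matrix ι (Fin p) ℝ) (σ : Fin p → ℝ) (V : Matrix κ (Fin p) ℝ) : Prop where
  left_orth : IsStiefel U
  right_orth : IsStiefel V
  nonneg : ∀ i, 0 ≤ σ i
  decreasing : Antitone σ
  eq : A = U * Matrix.diagonal σ * Vᵀ

/-- `[U, S, V] ← SVD_s(A)`: `U S Vᵀ` is a truncated SVD of rank `s` of `A`, that is, it is formed by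
the first `s` singular triplets of some SVD of `A`. -/
def IsTruncSVD {ι κ : Type*} [Fintype ι] [Fintype κ] {s : ℕ} (A : Matrix ι κ ℝ)
    (U : Matrix ι (Fin s) ℝ) (S : Matrix (Fin s) (Fin s) ℝ) (V : Matrix κ (Fin s) ℝ) : Prop :=
  ∃ (p : ℕ) (h : s ≤ p) (Uf : Matrix ι (Fin p) ℝ) (σ : Fin p → ℝ) (Vf : Matrix κ (Fin p) ℝ),
    IsSVD A Uf σ Vf ∧
    U = Uf.submatrix id (Fin.castLE h) ∧
    S = Matrix.diagonal (fun i => σ (Fin.castLE h i)) ∧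
    V = Vf.submatrix id (Fin.castLE h)

/-! ## Tensor-train rank, the variety, its tangent cone, metric projections -/

/-- `X` has a tensor-train decomposition `X = X1 · X2 · X3` of size `(q1, q2)`. -/
def HasTTD {n1 n2 n3 : ℕ} (X : Tensor n1 n2 n3) (q1 q2 : ℕ) : Prop :=
  ∃ (X1 : Matrix (Fin n1) (Fin q1) ℝ) (X2 : Tensor q1 n2 q2) (X3 : Matrix (Fin q2) (Fin n3) ℝ),
    X = lmul X1 (rmul X2 X3)

/-- `(r1, r2)` is the TT-rank of `X`: the minimal (least) size of a tensor-train decomposition. -/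
def IsTTRank {n1 n2 n3 : ℕ} (X : Tensor n1 n2 n3) (r1 r2 : ℕ) : Prop :=
  HasTTD X r1 r2 ∧ ∀ q1 q2 : ℕ, HasTTD X q1 q2 → r1 ≤ q1 ∧ r2 ≤ q2

/-- The tensors whose TT-rank is at most `(k1, k2)` entrywise. -/
def boundedTT (n1 n2 n3 k1 k2 : ℕ) : Set (Tensor n1 n2 n3) :=
  {X | ∃ q1 q2 : ℕ, IsTTRank X q1 q2 ∧ q1 ≤ k1 ∧ q2 ≤ k2}

/-- The (Bouligand) tangent cone at `X` to the tensors of TT-rank at most `(k1, k2)`: the limits of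
`c_n • d_n` with `c_n ≥ 0`, `d_n → 0` and `X + d_n` of TT-rank at most `(k1, k2)`. -/
def tangentCone {n1 n2 n3 : ℕ} (k1 k2 : ℕ) (X : Tensor n1 n2 n3) : Set (Tensor n1 n2 n3) :=
  tangentConeAt ℝ≥0 (boundedTT n1 n2 n3 k1 k2) X

/-- The set `argmin_{Z ∈ C} ‖Z - Y‖²`. -/
def metricProj {E : Type*} [NormedAddCommGroup E] (C : Set E) (Y : E) : Set E :=
  {Z | Z ∈ C ∧ ∀ W ∈ C, ‖Z - Y‖ ^ 2 ≤ ‖W - Y‖ ^ 2}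

/-! ## The two orthogonal tensor-train decompositions of `X` -/

/-- Decompositions `X = X1 · X2'' · X3'' = X1' · X2' · X3` with `(X2''^L)ᵀ`, `X3''ᵀ`, `X1'` and
`X2'^R` having orthonormal columns (suffix `p` stands for one prime, `pp` for two). -/
structure OrthTT {n1 n2 n3 : ℕ} (X : Tensor n1 n2 n3) (r1 r2 : ℕ) where
  X1 : Matrix (Fin n1) (Fin r1) ℝ
  X2pp : Tensor r1 n2 r2
  X3pp : Matrix (Fin r2) (Fin n3) ℝ
  X1p : Matrix (Fin n1) (Fin r1) ℝ
  X2p : Tensor r1 n2 r2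
  X3 : Matrix (Fin r2) (Fin n3) ℝ
  eq_pp : X = lmul X1 (rmul X2pp X3pp)
  eq_p : X = lmul X1p (rmul X2p X3)
  orth_X2pp : IsStiefel (lUnf X2pp)ᵀ
  orth_X3pp : IsStiefel X3ppᵀ
  orth_X1p : IsStiefel X1p
  orth_X2p : IsStiefel (rUnf X2p)

section Algorithm

variable {n1 n2 n3 r1 r2 : ℕ} {X : Tensor n1 n2 n3}

/-! ## The tensor determined by `U1` and `V3` -/

/-- `W1 = P_{X1'}^⊥ (Y · X3''ᵀ)^L (X2''^L)ᵀ`. -/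
def paramW1 (D : OrthTT X r1 r2) (Y : Tensor n1 n2 n3) : Matrix (Fin n1) (Fin r1) ℝ :=
  perp D.X1p * lUnf (rmul Y D.X3ppᵀ) * (lUnf D.X2pp)ᵀ

/-- `W3 = (X2'^R)ᵀ (X1'ᵀ · Y)^R P_{X3''ᵀ}^⊥`. -/
def paramW3 (D : OrthTT X r1 r2) (Y : Tensor n1 n2 n3) : Matrix (Fin r2) (Fin n3) ℝ :=
  (rUnf D.X2p)ᵀ * rUnf (lmul D.X1pᵀ Y) * perp D.X3ppᵀ

/-- `W2 = X1'ᵀ · Y · X3''ᵀ`. -/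
def paramW2 (D : OrthTT X r1 r2) (Y : Tensor n1 n2 n3) : Tensor r1 n2 r2 :=
  lmul D.X1pᵀ (rmul Y D.X3ppᵀ)

/-- The tensor `[(Y · X3''ᵀ)^L P_{(X2''^L)ᵀ}^⊥]` of size `n1 × n2 × r2`. -/
def leftRest (D : OrthTT X r1 r2) (Y : Tensor n1 n2 n3) : Tensor n1 n2 r2 :=
  lFold (lUnf (rmul Y D.X3ppᵀ) * perp (lUnf D.X2pp)ᵀ)

/-- The tensor `[P_{X2'^R}^⊥ (X1'ᵀ · Y)^R]` of size `r1 × n2 × n3`. -/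
def rightRest (D : OrthTT X r1 r2) (Y : Tensor n1 n2 n3) : Tensor r1 n2 n3 :=
  rFold (perp (rUnf D.X2p) * rUnf (lmul D.X1pᵀ Y))

/-- `U2 = [P_{X2'^R}^⊥ (X1'ᵀ · Y)^R] · V3ᵀ`. -/
def paramU2 {s2 : ℕ} (D : OrthTT X r1 r2) (Y : Tensor n1 n2 n3)
    (V3 : Matrix (Fin s2) (Fin n3) ℝ) : Tensor r1 n2 s2 :=
  rmul (rightRest D Y) V3ᵀ

/-- `V2 = U1ᵀ · [(Y · X3''ᵀ)^L P_{(X2''^L)ᵀ}^⊥]`. -/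
def paramV2 {s1 : ℕ} (D : OrthTT X r1 r2) (Y : Tensor n1 n2 n3)
    (U1 : Matrix (Fin n1) (Fin s1) ℝ) : Tensor s1 n2 r2 :=
  lmul U1ᵀ (leftRest D Y)

/-- `Z2 = U1ᵀ · Y · V3ᵀ`. -/
def paramZ2 {s1 s2 : ℕ} (Y : Tensor n1 n2 n3) (U1 : Matrix (Fin n1) (Fin s1) ℝ)
    (V3 : Matrix (Fin s2) (Fin n3) ℝ) : Tensor s1 n2 s2 :=
  lmul U1ᵀ (rmul Y V3ᵀ)

/-- The sum of six tensor trains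
`W1 · X2'' · X3'' + X1' · X2' · W3 + X1' · W2 · X3'' + U1 · V2 · X3'' + X1' · U2 · V3 + U1 · Z2 · V3`
with the parameters `W1, W2, W3, U2, V2, Z2` computed from `Y`, `U1` and `V3`. -/
def assemble {s1 s2 : ℕ} (D : OrthTT X r1 r2) (Y : Tensor n1 n2 n3)
    (U1 : Matrix (Fin n1) (Fin s1) ℝ) (V3 : Matrix (Fin s2) (Fin n3) ℝ) : Tensor n1 n2 n3 :=
  lmul (paramW1 D Y) (rmul D.X2pp D.X3pp)
    + lmul D.X1p (rmul D.X2p (paramW3 D Y))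
    + lmul D.X1p (rmul (paramW2 D Y) D.X3pp)
    + lmul U1 (rmul (paramV2 D Y U1) D.X3pp)
    + lmul D.X1p (rmul (paramU2 D Y V3) V3)
    + lmul U1 (rmul (paramZ2 Y U1 V3) V3)

/-! ## The alternating algorithm computing `U1` and `V3` -/

/-- `P_{X1'}^⊥ ((Y · P_{V3ᵀ})^L + (Y · X3''ᵀ)^L P_{(X2''^L)ᵀ}^⊥ (X3'' ⊗ I))`; multiplication of a left
unfolding by `X3'' ⊗ I` is contraction of the tensor with `X3''` along the third mode. -/
def leftMat {q : ℕ} (D : OrthTT X r1 r2) (Y : Tensor n1 n2 n3)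
    (V3 : Matrix (Fin q) (Fin n3) ℝ) : Matrix (Fin n1) (Fin n2 × Fin n3) ℝ :=
  perp D.X1p * (lUnf (rmul Y (proj V3ᵀ)) + lUnf (rmul (leftRest D Y) D.X3pp))

/-- `((P_{U1} · Y)^R + (I ⊗ X1') P_{X2'^R}^⊥ (X1'ᵀ · Y)^R) P_{X3''ᵀ}^⊥`; multiplication of a right
unfolding by `I ⊗ X1'` is contraction of the tensor with `X1'` along the first mode. -/
def rightMat {p : ℕ} (D : OrthTT X r1 r2) (Y : Tensor n1 n2 n3)
    (U1 : Matrix (Fin n1) (Fin p) ℝ) : Matrix (Fin n1 × Fin n2) (Fin n3) ℝ :=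
  (rUnf (lmul (proj U1) Y) + rUnf (lmul D.X1p (rightRest D Y))) * perp D.X3ppᵀ

/-- `[U1, S, ∼] ← SVD_{s1}(leftMat)`, where `U1` has to be an admissible parameter: `U1ᵀ X1' = 0`
(automatic unless the rank of the decomposed matrix is less than `s1`). -/
def SelectU {s1 q : ℕ} (D : OrthTT X r1 r2) (Y : Tensor n1 n2 n3)
    (V3 : Matrix (Fin q) (Fin n3) ℝ)
    (U1 : Matrix (Fin n1) (Fin s1) ℝ) (S : Matrix (Fin s1) (Fin s1) ℝ) : Prop :=
  (∃ V, IsTruncSVD (leftMat D Y V3) U1 S V) ∧ U1ᵀ * D.X1p = 0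

/-- `[∼, S, V3ᵀ] ← SVD_{s2}(rightMat)`, where `V3` has to be an admissible parameter:
`V3 X3''ᵀ = 0` (automatic unless the rank of the decomposed matrix is less than `s2`). -/
def SelectV {s2 p : ℕ} (D : OrthTT X r1 r2) (Y : Tensor n1 n2 n3)
    (U1 : Matrix (Fin n1) (Fin p) ℝ)
    (V3 : Matrix (Fin s2) (Fin n3) ℝ) (S : Matrix (Fin s2) (Fin s2) ℝ) : Prop :=
  (∃ U, IsTruncSVD (rightMat D Y U1) U S V3ᵀ) ∧ V3 * D.X3ppᵀ = 0

/-- Values of the program variables; the numbers of columns of `U1` and of rows of `V3` are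
`n1` and `n3` initially, and `s1` and `s2` after the first pass through the loop. -/
structure AlgState (n1 n3 : ℕ) where
  p : ℕ
  q : ℕ
  U1 : Matrix (Fin n1) (Fin p) ℝ
  V3 : Matrix (Fin q) (Fin n3) ℝ
  i : ℕ
  eta1 : EReal
  etaNew : EReal

/-- `i ← 0, V3 ← P_{X3''ᵀ}^⊥, U1 ← P_{X1'}^⊥, η₁ ← 0, η_new ← ∞`. -/
def algInit (D : OrthTT X r1 r2) : AlgState n1 n3 :=
  ⟨n1, n3, perp D.X1p, perp D.X3ppᵀ, 0, 0, ⊤⟩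

/-- The loop condition `i < i_max and |η_new - η₁| > ε`. -/
def algGuard (ε : ℝ) (imax : ℕ) (st : AlgState n1 n3) : Prop :=
  st.i < imax ∧ ENNReal.ofReal ε < (st.etaNew - st.eta1).abs

/-- Loop body when `s2 / (n3 - r2) > s1 / (n1 - r1)`: first `U1`, then `V3`. -/
def bodyUV (s1 s2 : ℕ) (D : OrthTT X r1 r2) (Y : Tensor n1 n2 n3)
    (st st' : AlgState n1 n3) : Prop :=
  ∃ (U1 : Matrix (Fin n1) (Fin s1) ℝ) (S1 : Matrix (Fin s1) (Fin s1) ℝ)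
    (V3 : Matrix (Fin s2) (Fin n3) ℝ) (S : Matrix (Fin s2) (Fin s2) ℝ),
    SelectU D Y st.V3 U1 S1 ∧ SelectV D Y U1 V3 S ∧
    st' = ⟨s1, s2, U1, V3, st.i + 1, st.etaNew,
      ((frobSq S + frobSq (proj U1 * lUnf (rmul (leftRest D Y) D.X3pp)) : ℝ) : EReal)⟩

/-- Loop body in the other case: first `V3`, then `U1`. -/
def bodyVU (s1 s2 : ℕ) (D : OrthTT X r1 r2) (Y : Tensor n1 n2 n3)
    (st st' : AlgState n1 n3) : Prop :=
  ∃ (V3 : Matrix (Fin s2) (Fin n3) ℝ) (S2 : Matrix (Fin s2) (Fin s2) ℝ)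
    (U1 : Matrix (Fin n1) (Fin s1) ℝ) (S : Matrix (Fin s1) (Fin s1) ℝ),
    SelectV D Y st.U1 V3 S2 ∧ SelectU D Y V3 U1 S ∧
    st' = ⟨s1, s2, U1, V3, st.i + 1, st.etaNew,
      ((frobSq S + frobSq (rUnf (lmul D.X1p (rightRest D Y)) * proj V3ᵀ) : ℝ) : EReal)⟩

/-- One pass through the while loop, the loop condition being satisfied. -/
def algStep (s1 s2 : ℕ) (ε : ℝ) (imax : ℕ) (D : OrthTT X r1 r2) (Y : Tensor n1 n2 n3)
    (st st' : AlgState n1 n3) : Prop :=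
  algGuard ε imax st ∧
    (((s1 : ℝ) / ((n1 : ℝ) - r1) < (s2 : ℝ) / ((n3 : ℝ) - r2) ∧ bodyUV s1 s2 D Y st st') ∨
     (¬ (s1 : ℝ) / ((n1 : ℝ) - r1) < (s2 : ℝ) / ((n3 : ℝ) - r2) ∧ bodyVU s1 s2 D Y st st'))

/-- `(U1, V3)` is a possible output: a state in which the loop condition fails and that is reached
from the initial state by passes through the loop. -/
def IsAlgOutput {s1 s2 : ℕ} (ε : ℝ) (imax : ℕ) (D : OrthTT X r1 r2) (Y : Tensor n1 n2 n3)
    (U1 : Matrix (Fin n1) (Fin s1) ℝ) (V3 : Matrix (Fin s2) (Fin n3) ℝ) : Prop :=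
  ∃ (i : ℕ) (eta1 etaNew : EReal),
    Relation.ReflTransGen (algStep s1 s2 ε imax D Y) (algInit D) ⟨s1, s2, U1, V3, i, eta1, etaNew⟩ ∧
    ¬ algGuard ε imax (⟨s1, s2, U1, V3, i, eta1, etaNew⟩ : AlgState n1 n3)

/-- The set-valued approximate projection of `Y`, with `(s1, s2) = (k1 - r1, k2 - r2)`. -/
def approxProj (k1 k2 : ℕ) (ε : ℝ) (imax : ℕ) (D : OrthTT X r1 r2) (Y : Tensor n1 n2 n3) :
    Set (Tensor n1 n2 n3) :=
  {Yt | ∃ (U1 : Matrix (Fin n1) (Fin (k1 - r1)) ℝ) (V3 : Matrix (Fin (k2 - r2)) (Fin n3) ℝ),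
    IsAlgOutput ε imax D Y U1 V3 ∧ Yt = assemble D Y U1 V3}

end Algorithm

/-- The constant `ω = √(max {(k1 - r1)/(n1 - r1), (k2 - r2)/(n3 - r2)})` (with `0/0 = 0`). -/
def omega (n1 n3 r1 r2 k1 k2 : ℕ) : ℝ :=
  √(max (((k1 : ℝ) - r1) / ((n1 : ℝ) - r1)) (((k2 : ℝ) - r2) / ((n3 : ℝ) - r2)))

end TTCone

end

noncomputable section

namespace TTCone

/-! ## Matrices with orthonormal columns -/

section Stiefel

variable {ι κ : Type*} [Fintype ι] [Fintype κ]

/-! Four orthogonal projectors on the tensor space describe `X`: `P` and `R` project onto the column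
and row space of its left unfolding, `K` and `Q` onto the column and row space of its right
unfolding. Let `u` and `v` be the projectors given by `U1` and `V3`. By `OrthTT.assemble_eq` the
computed tensor is `F Y` with `F = frameProj P Q R K u v`, and `F` is an orthogonal projector. Hence
`⟨Y, F Y⟩ = ‖F Y‖²`, and it remains to bound `‖F Y‖` below by `ω ‖Ŷ‖`.

The range of each `F` lies in the tangent cone, because its elements are velocities of explicit
block tensor trains (`mem_tangentCone_of_block`). Conversely, every tangent vector lies in the range
of some `F`: the projectors onto the column spaces of nearby tensors of bounded rank accumulate at a
projector of the form `P + u`, and likewise on the right at `Q + v`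
(`OrthTT.exists_left_of_mem_tangentCone`, `OrthTT.exists_right_of_mem_tangentCone`). Together with
`one_sub_frameProj` this gives `‖Ŷ‖ ≤ ‖F' Y‖` for some choice `(u', v')`.

By `norm_sq_frameProj`, `‖F Y‖²` is a constant plus `gain`, so it suffices that the algorithm
reaches the fraction `ω²` of every possible gain. In the first pass, the first SVD is optimal
against the full complement on the other side, and the second keeps `s` singular values of a matrix
of rank at most `d`, hence at least the fraction `s / d` of its energy; the order of the two SVDs
makes this fraction the larger of the two (`mul_gain_le_of_choice`). Each later SVD maximizes the
gain in one variable, so the bound persists (`good_of_reflTransGen`). -/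

theorem IsStiefel.sum_mul {p : ℕ} {U : Matrix ι (Fin p) ℝ} (hU : IsStiefel U) (i j : Fin p) :
    ∑ a, U a i * U a j = if i = j then 1 else 0 := by
  have := congrFun (congrFun hU i) j
  simpa [Matrix.mul_apply, Matrix.one_apply] using this

theorem IsStiefel.orthonormal {p : ℕ} {U : Matrix ι (Fin p) ℝ} (hU : IsStiefel U) :
    Orthonormal ℝ (fun j => WithLp.toLp 2 (fun i => U i j) : Fin p → EuclideanSpace ℝ ι) := by
  classical
  rw [orthonormal_iff_ite]
  intro i j
  simp only [PiLp.inner_apply, RCLike.inner_apply, conj_trivial]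
  rw [← hU.sum_mul i j]
  exact Finset.sum_congr rfl fun _ _ => mul_comm _ _

theorem isStiefel_of_orthonormal {p : ℕ} {v : Fin p → EuclideanSpace ℝ ι} (hv : Orthonormal ℝ v) :
    IsStiefel (Matrix.of fun i j => v j i) := by
  classical
  rw [orthonormal_iff_ite] at hv
  ext i j
  have := hv i j
  simp only [PiLp.inner_apply, RCLike.inner_apply, conj_trivial] at this
  simp only [Matrix.mul_apply, Matrix.transpose_apply, Matrix.of_apply, Matrix.one_apply, ← this]
  exact Finset.sum_congr rfl fun _ _ => mul_comm _ _

theorem orthonormalBasis_sum_mul [DecidableEq ι] (b : OrthonormalBasis κ ℝ (EuclideanSpace ℝ ι))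
    (i j : ι) : ∑ k, b k i * b k j = if i = j then 1 else 0 := by
  have := b.sum_inner_mul_inner (EuclideanSpace.single i 1) (EuclideanSpace.single j 1)
  simpa [EuclideanSpace.inner_single_left, EuclideanSpace.inner_single_right, Pi.single_apply,
    eq_comm] using this

theorem IsStiefel.le_card {p : ℕ} {U : Matrix ι (Fin p) ℝ} (hU : IsStiefel U) :
    p ≤ Fintype.card ι := by
  have := hU.orthonormal.linearIndependent.fintype_card_le_finrank
  simpa using this

/-- Orthonormal columns extend to an orthonormal basis. -/
theorem IsStiefel.exists_complement {n r : ℕ} {U : Matrix (Fin n) (Fin r) ℝ} (hU : IsStiefel U) :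
    ∃ E : Matrix (Fin n) (Fin (n - r)) ℝ, IsStiefel E ∧ Uᵀ * E = 0 ∧ U * Uᵀ + E * Eᵀ = 1 := by
  obtain ⟨m, rfl⟩ := Nat.exists_eq_add_of_le (by simpa using hU.le_card : r ≤ n)
  rw [Nat.add_sub_cancel_left]
  -- The zero padding is irrelevant: only the values at the first `r` indices are prescribed when
  -- extending to a basis.
  set v : Fin (r + m) → EuclideanSpace ℝ (Fin (r + m)) :=
    Fin.append (fun j => WithLp.toLp 2 (fun i => U i j)) 0 with hv
  have hs : Orthonormal ℝ ((Set.range (Fin.castAdd m : Fin r → Fin (r + m))).domRestrict v) := by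
    have h1 := hU.orthonormal
    rw [orthonormal_iff_ite] at h1 ⊢
    rintro ⟨_, i, rfl⟩ ⟨_, j, rfl⟩
    have := h1 i j
    simpa [hv, Fin.append_left, Set.domRestrict, Subtype.ext_iff] using this
  obtain ⟨b, hb⟩ := hs.exists_orthonormalBasis_extension_of_card_eq (by simp)
  have hbU : ∀ i j, b (Fin.castAdd m j) i = U i j := by
    intro i j
    rw [hb _ ⟨j, rfl⟩]
    simp [hv]
  have hort := b.orthonormal
  refine ⟨Matrix.of fun i j => b (Fin.natAdd r j) i,
    isStiefel_of_orthonormal (hort.comp _ (Fin.natAdd_injective _ _)), ?_, ?_⟩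
  · rw [orthonormal_iff_ite] at hort
    ext i j
    have := hort (Fin.castAdd m i) (Fin.natAdd r j)
    rw [if_neg (by simp [Fin.ext_iff]; omega)] at this
    simp only [PiLp.inner_apply, RCLike.inner_apply, conj_trivial] at this
    simp only [Matrix.mul_apply, Matrix.transpose_apply, Matrix.of_apply, Matrix.zero_apply,
      ← this, ← hbU]
    exact Finset.sum_congr rfl fun _ _ => mul_comm _ _
  · ext i j
    have := orthonormalBasis_sum_mul b i j
    rw [Fin.sum_univ_add] at this
    simpa [Matrix.mul_apply, Matrix.one_apply, hbU] using this

/-- The columns of a matrix lie in the span of sufficiently many orthonormal vectors. -/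
theorem exists_isStiefel_proj_mul_eq {n q k : ℕ} (M : Matrix (Fin n) (Fin q) ℝ) (hqk : q ≤ k)
    (hkn : k ≤ n) : ∃ A : Matrix (Fin n) (Fin k) ℝ, IsStiefel A ∧ A * Aᵀ * M = M := by
  obtain ⟨m, rfl⟩ := Nat.exists_eq_add_of_le hkn
  set f : Fin (k + m) → EuclideanSpace ℝ (Fin (k + m)) := fun j =>
    if h : (j : ℕ) < q then WithLp.toLp 2 (fun i => M i ⟨j, h⟩) else 0 with hf
  -- By triangularity of Gram–Schmidt, a column with index below `q ≤ k` has no component along the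
  -- basis vectors with index at least `k`.
  set b := InnerProductSpace.gramSchmidtOrthonormalBasis (𝕜 := ℝ) (by simp) f with hb
  refine ⟨Matrix.of fun i j => b (Fin.castAdd m j) i,
    isStiefel_of_orthonormal (b.orthonormal.comp _ (Fin.castAdd_injective _ _)), ?_⟩
  rw [Matrix.mul_assoc]
  ext i j
  have hj : ((⟨j, by omega⟩ : Fin (k + m)) : ℕ) < q := j.2
  have hfj : ∀ i, f ⟨j, by omega⟩ i = M i j := by
    intro i
    simp only [hf]
    rw [dif_pos hj]
  have h1 := congrArg (fun v : EuclideanSpace ℝ (Fin (k + m)) => v i)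
    (b.sum_repr' (f ⟨j, by omega⟩))
  simp only [Fin.sum_univ_add] at h1
  have h2 : ∀ l : Fin m, inner ℝ (b (Fin.natAdd k l)) (f ⟨j, by omega⟩) = 0 := fun l =>
    InnerProductSpace.gramSchmidtOrthonormalBasis_inv_triangular _ f
      (by rw [Fin.lt_def]; simp; omega)
  simp only [h2, zero_smul, Finset.sum_const_zero, add_zero] at h1
  rw [hfj] at h1
  rw [← h1]
  simp only [Matrix.mul_apply, Matrix.of_apply, Matrix.transpose_apply, WithLp.ofLp_sum,
    Finset.sum_apply, PiLp.smul_apply, smul_eq_mul]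
  refine Finset.sum_congr rfl fun l _ => ?_
  rw [mul_comm]
  congr 1
  simp only [PiLp.inner_apply, RCLike.inner_apply, conj_trivial, hfj]
  exact Finset.sum_congr rfl fun _ _ => mul_comm _ _

/-- The difference of nested orthogonal projectors is an orthogonal projector. -/
theorem IsStiefel.exists_sub {n r k : ℕ} {U : Matrix (Fin n) (Fin r) ℝ}
    {A : Matrix (Fin n) (Fin k) ℝ} (hU : IsStiefel U) (hA : IsStiefel A) (h : A * Aᵀ * U = U) :
    ∃ E : Matrix (Fin n) (Fin (k - r)) ℝ, IsStiefel E ∧ Uᵀ * E = 0 ∧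
      A * Aᵀ = U * Uᵀ + E * Eᵀ := by
  -- In the coordinates `Aᵀ` the columns of `U` stay orthonormal, so their complement `F` in
  -- dimension `k` can be carried back by `A`.
  have hAU : IsStiefel (Aᵀ * U) := by
    unfold IsStiefel at *
    rw [Matrix.transpose_mul, Matrix.transpose_transpose, Matrix.mul_assoc, ← Matrix.mul_assoc A, h,
      hU]
  obtain ⟨F, hF, hUF, hsum⟩ := hAU.exists_complement
  refine ⟨A * F, ?_, ?_, ?_⟩
  · unfold IsStiefel at *
    rw [Matrix.transpose_mul, Matrix.mul_assoc, ← Matrix.mul_assoc Aᵀ, hA, Matrix.one_mul, hF]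
  · rw [← hUF, Matrix.transpose_mul, Matrix.transpose_transpose, Matrix.mul_assoc]
  · have h2 : A * (Aᵀ * U * (Aᵀ * U)ᵀ + F * Fᵀ) * Aᵀ = A * Aᵀ := by rw [hsum, Matrix.mul_one]
    rw [← h2]
    simp only [Matrix.transpose_mul, Matrix.transpose_transpose, Matrix.mul_add, Matrix.add_mul]
    have h3 : A * (Aᵀ * U * (Uᵀ * A)) * Aᵀ = (A * Aᵀ * U) * (A * Aᵀ * U)ᵀ := by
      simp only [Matrix.transpose_mul, Matrix.transpose_transpose, Matrix.mul_assoc]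
    rw [h3, h]
    simp only [Matrix.mul_assoc]

/-- A singular square matrix factors through a smaller dimension. -/
theorem exists_mul_eq_of_not_isUnit {r : ℕ} (R : Matrix (Fin r) (Fin r) ℝ) (hR : ¬ IsUnit R) :
    ∃ q < r, ∃ (E : Matrix (Fin r) (Fin q) ℝ) (F : Matrix (Fin q) (Fin r) ℝ), R = E * F := by
  have hdet : R.det = 0 := by
    by_contra h
    exact hR ((Matrix.isUnit_iff_isUnit_det R).2 (isUnit_iff_ne_zero.2 h))
  obtain ⟨w, hw, hwR⟩ := Matrix.exists_vecMul_eq_zero_iff.2 hdet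
  obtain ⟨i0, hi0⟩ := Function.ne_iff.1 hw
  have hpos : 0 < ∑ i, w i ^ 2 :=
    Finset.sum_pos' (fun i _ => sq_nonneg _) ⟨i0, Finset.mem_univ _, by
      have : w i0 ≠ 0 := hi0
      positivity⟩
  set c := √(∑ i, w i ^ 2) with hc
  have hc2 : c ^ 2 = ∑ i, w i ^ 2 := Real.sq_sqrt hpos.le
  have hc0 : c ≠ 0 := (Real.sqrt_pos.2 hpos).ne'
  -- A normalized left null vector of `R`, seen as a one-column frame; its complement has `r - 1`
  -- columns and its span contains the columns of `R`.
  set U : Matrix (Fin r) (Fin 1) ℝ := Matrix.of fun i _ => w i / c with hUdef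
  have hU : IsStiefel U := by
    ext i j
    have : ∑ x, w x / c * (w x / c) = 1 := by
      rw [← div_self (pow_ne_zero 2 hc0)]
      conv_rhs => rw [hc2, Finset.sum_div]
      refine Finset.sum_congr rfl fun x _ => ?_
      rw [← hc2]; ring
    simpa [hUdef, Matrix.mul_apply, Matrix.one_apply, Subsingleton.elim i j] using this
  have hUR : Uᵀ * R = 0 := by
    ext i j
    have := congrFun hwR j
    simp only [Matrix.vecMul, dotProduct, Pi.zero_apply] at this
    simp only [hUdef, Matrix.mul_apply, Matrix.transpose_apply, Matrix.of_apply, Matrix.zero_apply,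
      div_mul_eq_mul_div]
    rw [← Finset.sum_div, this, zero_div]
  obtain ⟨E, -, -, hE⟩ := hU.exists_complement
  refine ⟨r - 1, by have := i0.2; omega, E, Eᵀ * R, ?_⟩
  rw [← Matrix.mul_assoc, eq_sub_of_add_eq' hE, Matrix.sub_mul, Matrix.one_mul,
    Matrix.mul_assoc, hUR, Matrix.mul_zero, sub_zero]

end Stiefel

/-! ## Truncated singular value decompositions -/

/-! ### Rearrangement inequalities for decreasing sequences -/

section Sums

/-- The threshold is the first value of the tail, or `0` when the tail is empty. -/
theorem exists_threshold {s m : ℕ} {τ : Fin (s + m) → ℝ} (hτ : Antitone τ) (h0 : ∀ i, 0 ≤ τ i) :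
    ∃ t, 0 ≤ t ∧ (∀ i : Fin s, t ≤ τ (Fin.castAdd m i)) ∧ ∀ i : Fin m, τ (Fin.natAdd s i) ≤ t := by
  rcases m with _ | m
  · exact ⟨0, le_rfl, fun i => h0 _, fun i => i.elim0⟩
  · refine ⟨τ (Fin.natAdd s 0), h0 _, fun i => hτ ?_, fun i => hτ ?_⟩
    · rw [Fin.le_def]; simp
    · rw [Fin.le_def]; simp

/-- Bathtub principle: weights between `0` and `1` of total mass at most `s` are best spent on the
`s` largest values. It yields the optimality of truncated SVDs. -/
theorem sum_mul_le_sum_head {s m : ℕ} {τ c : Fin (s + m) → ℝ} (hτ : Antitone τ)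
    (h0 : ∀ i, 0 ≤ τ i) (hc0 : ∀ i, 0 ≤ c i) (hc1 : ∀ i, c i ≤ 1) (hc : ∑ i, c i ≤ s) :
    ∑ i, τ i * c i ≤ ∑ i : Fin s, τ (Fin.castAdd m i) := by
  obtain ⟨t, ht, h1, h2⟩ := exists_threshold hτ h0
  rw [Fin.sum_univ_add] at hc ⊢
  have e1 : ∑ i : Fin m, τ (Fin.natAdd s i) * c (Fin.natAdd s i)
      ≤ t * ∑ i : Fin m, c (Fin.natAdd s i) := by
    rw [Finset.mul_sum]
    exact Finset.sum_le_sum fun i _ => mul_le_mul_of_nonneg_right (h2 i) (hc0 _)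
  have e2 : t * ∑ i : Fin s, (1 - c (Fin.castAdd m i))
      ≤ ∑ i : Fin s, τ (Fin.castAdd m i) * (1 - c (Fin.castAdd m i)) := by
    rw [Finset.mul_sum]
    exact Finset.sum_le_sum fun i _ => mul_le_mul_of_nonneg_right (h1 i) (sub_nonneg.2 (hc1 _))
  simp only [mul_sub, mul_one, Finset.sum_sub_distrib, Finset.sum_const, Finset.card_univ,
    Fintype.card_fin, nsmul_eq_mul] at e2
  nlinarith [mul_le_mul_of_nonneg_left hc ht]

/-- The weights `w` encode that at most `d` of the values are nonzero; then the average of the `s`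
largest is at least the total divided by `d`. -/
theorem mul_sum_le_mul_sum_head {s m d : ℕ} {τ w : Fin (s + m) → ℝ} (hτ : Antitone τ)
    (h0 : ∀ i, 0 ≤ τ i) (hw0 : ∀ i, 0 ≤ w i) (hw1 : ∀ i, τ i ≠ 0 → w i = 1) (hw : ∑ i, w i ≤ d)
    (hsd : s ≤ d) : s * ∑ i, τ i ≤ d * ∑ i : Fin s, τ (Fin.castAdd m i) := by
  obtain ⟨t, ht, h1, h2⟩ := exists_threshold hτ h0
  have hsd' : (s : ℝ) ≤ d := by exact_mod_cast hsd
  rw [Fin.sum_univ_add] at hw ⊢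
  have hhead : s * t ≤ ∑ i : Fin s, τ (Fin.castAdd m i) := by
    simpa using Finset.sum_le_sum fun (i : Fin s) (_ : i ∈ Finset.univ) => h1 i
  -- If no head value vanishes, the head uses up weight exactly `s` and leaves at most `d - s` for
  -- the tail. Otherwise the threshold is `0` and the whole tail vanishes.
  by_cases hz : ∀ i : Fin s, τ (Fin.castAdd m i) ≠ 0
  · have e1 : ∑ i : Fin m, τ (Fin.natAdd s i) ≤ t * ∑ i : Fin m, w (Fin.natAdd s i) := by
      rw [Finset.mul_sum]
      refine Finset.sum_le_sum fun i _ => ?_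
      by_cases hi : τ (Fin.natAdd s i) = 0
      · rw [hi]; exact mul_nonneg ht (hw0 _)
      · rw [hw1 _ hi, mul_one]; exact h2 i
    have e2 : ∑ i : Fin s, w (Fin.castAdd m i) = s := by
      simp [hw1 _ (hz _)]
    rw [e2] at hw
    have e3 : t * ∑ i : Fin m, w (Fin.natAdd s i) ≤ t * (d - s) :=
      mul_le_mul_of_nonneg_left (by linarith) ht
    have hs0 : (0 : ℝ) ≤ s := Nat.cast_nonneg _
    nlinarith [mul_le_mul_of_nonneg_left (e1.trans e3) hs0,
      mul_le_mul_of_nonneg_left hhead (sub_nonneg.2 hsd')]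
  · push Not at hz
    obtain ⟨i, hi⟩ := hz
    have ht0 : t = 0 := le_antisymm (hi ▸ h1 i) ht
    have e1 : ∑ i : Fin m, τ (Fin.natAdd s i) = 0 :=
      Finset.sum_eq_zero fun j _ => le_antisymm (ht0 ▸ h2 j) (h0 _)
    rw [e1, add_zero]
    exact mul_le_mul_of_nonneg_right hsd' (Finset.sum_nonneg fun _ _ => h0 _)

end Sums

/-! ### Frobenius norm and Bessel inequalities -/

section Frob

variable {ι κ μ : Type*} [Fintype ι] [Fintype κ] [Fintype μ]

theorem frobSq_eq_trace (M : Matrix ι κ ℝ) : frobSq M = (Mᵀ * M).trace := by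
  simp only [frobSq, Matrix.trace, Matrix.diag, Matrix.mul_apply, Matrix.transpose_apply]
  rw [Finset.sum_comm]
  exact Finset.sum_congr rfl fun _ _ => Finset.sum_congr rfl fun _ _ => sq _

theorem frobSq_nonneg (M : Matrix ι κ ℝ) : 0 ≤ frobSq M :=
  Finset.sum_nonneg fun _ _ => Finset.sum_nonneg fun _ _ => sq_nonneg _

theorem frobSq_transpose (M : Matrix ι κ ℝ) : frobSq Mᵀ = frobSq M := by
  simp only [frobSq, Matrix.transpose_apply]
  exact Finset.sum_comm

theorem IsStiefel.frobSq_mul {p : ℕ} {U : Matrix ι (Fin p) ℝ} (hU : IsStiefel U)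
    (M : Matrix (Fin p) κ ℝ) : frobSq (U * M) = frobSq M := by
  rw [frobSq_eq_trace, frobSq_eq_trace, Matrix.transpose_mul, Matrix.mul_assoc,
    ← Matrix.mul_assoc Uᵀ, show Uᵀ * U = 1 from hU, Matrix.one_mul]

theorem IsStiefel.frobSq_mul_transpose {p : ℕ} {V : Matrix ι (Fin p) ℝ} (hV : IsStiefel V)
    (M : Matrix κ (Fin p) ℝ) : frobSq (M * Vᵀ) = frobSq M := by
  rw [← frobSq_transpose, Matrix.transpose_mul, Matrix.transpose_transpose, hV.frobSq_mul,
    frobSq_transpose]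

theorem IsStiefel.frobSq_proj_mul {p : ℕ} {U : Matrix ι (Fin p) ℝ} (hU : IsStiefel U)
    (M : Matrix ι κ ℝ) : frobSq (proj U * M) = frobSq (Uᵀ * M) := by
  rw [proj, Matrix.mul_assoc, hU.frobSq_mul]

theorem IsStiefel.frobSq_transpose_mul_le {p : ℕ} {U : Matrix ι (Fin p) ℝ} (hU : IsStiefel U)
    (M : Matrix ι κ ℝ) : frobSq (Uᵀ * M) ≤ frobSq M := by
  have h : frobSq (M - U * (Uᵀ * M)) = frobSq M - frobSq (Uᵀ * M) := by
    simp only [frobSq_eq_trace, Matrix.transpose_sub, Matrix.transpose_mul,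
      Matrix.transpose_transpose, Matrix.sub_mul, Matrix.mul_sub, Matrix.trace_sub]
    have h1 : Mᵀ * U * Uᵀ * (U * (Uᵀ * M)) = Mᵀ * U * (Uᵀ * M) := by
      rw [Matrix.mul_assoc (Mᵀ * U), ← Matrix.mul_assoc Uᵀ, show Uᵀ * U = 1 from hU,
        Matrix.one_mul]
    rw [h1]
    simp only [Matrix.mul_assoc]
    ring
  linarith [frobSq_nonneg (M - U * (Uᵀ * M))]

theorem IsStiefel.frobSq_eq {p : ℕ} {U : Matrix ι (Fin p) ℝ} (hU : IsStiefel U) :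
    frobSq U = p := by
  rw [frobSq_eq_trace, show Uᵀ * U = 1 from hU]
  simp

theorem frobSq_col {κ : Type*} (M : Matrix ι κ ℝ) (j : κ) :
    frobSq (M.submatrix id (fun _ : Fin 1 => j)) = ∑ i, M i j ^ 2 := by
  simp [frobSq]

theorem frobSq_mul_diagonal {p : ℕ} (M : Matrix ι (Fin p) ℝ) (σ : Fin p → ℝ) :
    frobSq (M * Matrix.diagonal σ) = ∑ j, σ j ^ 2 * ∑ i, M i j ^ 2 := by
  simp only [frobSq, Matrix.mul_diagonal, mul_pow]
  rw [Finset.sum_comm]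
  exact Finset.sum_congr rfl fun _ _ => by
    rw [Finset.mul_sum]; exact Finset.sum_congr rfl fun _ _ => mul_comm _ _

/-- Bessel's inequality for a single column of `U`, treated as a one-column matrix. -/
theorem IsStiefel.sum_sq_transpose_mul_le_one {p q : ℕ} {W : Matrix ι (Fin q) ℝ}
    {U : Matrix ι (Fin p) ℝ} (hW : IsStiefel W) (hU : IsStiefel U) (j : Fin p) :
    ∑ a, (Wᵀ * U) a j ^ 2 ≤ 1 := by
  have h := hW.frobSq_transpose_mul_le (U.submatrix id (fun _ : Fin 1 => j))
  rw [frobSq_col] at h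
  have h1 : Wᵀ * U.submatrix id (fun _ : Fin 1 => j)
      = (Wᵀ * U).submatrix id (fun _ : Fin 1 => j) := by
    ext a b; simp [Matrix.mul_apply]
  rw [h1, frobSq_col] at h
  refine h.trans (le_of_eq ?_)
  have := hU.sum_mul j j
  simpa [sq] using this

/-- Bessel's inequality with the roles exchanged: projecting `W` onto the columns of `U` cannot
increase `‖W‖² = q`. -/
theorem IsStiefel.sum_sum_sq_transpose_mul_le {p q : ℕ} {W : Matrix ι (Fin q) ℝ}
    {U : Matrix ι (Fin p) ℝ} (hW : IsStiefel W) (hU : IsStiefel U) :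
    ∑ j, ∑ a, (Wᵀ * U) a j ^ 2 ≤ q := by
  rw [Finset.sum_comm]
  change frobSq (Wᵀ * U) ≤ q
  rw [← frobSq_transpose, Matrix.transpose_mul, Matrix.transpose_transpose, ← hW.frobSq_eq]
  exact hU.frobSq_transpose_mul_le W

end Frob

/-! ### Energy captured by truncated SVDs, and their existence -/

section SVD

variable {ι κ : Type*} [Fintype ι] [Fintype κ]

theorem IsSVD.transpose {p : ℕ} {A : Matrix ι κ ℝ} {U : Matrix ι (Fin p) ℝ} {σ : Fin p → ℝ}
    {V : Matrix κ (Fin p) ℝ} (h : IsSVD A U σ V) : IsSVD Aᵀ V σ U :=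
  ⟨h.right_orth, h.left_orth, h.nonneg, h.decreasing, by
    rw [h.eq]
    simp only [Matrix.transpose_mul, Matrix.transpose_transpose, Matrix.diagonal_transpose,
      Matrix.mul_assoc]⟩

theorem IsTruncSVD.transpose {s : ℕ} {A : Matrix ι κ ℝ} {U : Matrix ι (Fin s) ℝ}
    {S : Matrix (Fin s) (Fin s) ℝ} {V : Matrix κ (Fin s) ℝ} (h : IsTruncSVD A U S V) :
    IsTruncSVD Aᵀ V S U := by
  obtain ⟨p, hp, Uf, σ, Vf, hA, hU, hS, hV⟩ := h
  exact ⟨p, hp, Vf, σ, Uf, hA.transpose, hV, hS, hU⟩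

theorem IsStiefel.submatrix {p s : ℕ} {U : Matrix ι (Fin p) ℝ} (hU : IsStiefel U)
    {e : Fin s → Fin p} (he : Function.Injective e) : IsStiefel (U.submatrix id e) := by
  ext i j
  have := hU.sum_mul (e i) (e j)
  simpa [Matrix.mul_apply, Matrix.one_apply, he.eq_iff] using this

theorem IsTruncSVD.isStiefel_left {s : ℕ} {A : Matrix ι κ ℝ} {U : Matrix ι (Fin s) ℝ}
    {S : Matrix (Fin s) (Fin s) ℝ} {V : Matrix κ (Fin s) ℝ} (h : IsTruncSVD A U S V) :
    IsStiefel U := by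
  obtain ⟨p, hp, Uf, σ, Vf, hA, rfl, -, -⟩ := h
  exact hA.left_orth.submatrix (Fin.castLE_injective hp)

/-- Turns captured energy into a weighted sum of squared singular values, the form needed by the
rearrangement inequalities. -/
theorem IsSVD.frobSq_transpose_mul {p q : ℕ} {A : Matrix ι κ ℝ} {U : Matrix ι (Fin p) ℝ}
    {σ : Fin p → ℝ} {V : Matrix κ (Fin p) ℝ} (h : IsSVD A U σ V) (W : Matrix ι (Fin q) ℝ) :
    frobSq (Wᵀ * A) = ∑ j, σ j ^ 2 * ∑ a, (Wᵀ * U) a j ^ 2 := by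
  rw [← frobSq_mul_diagonal, ← h.right_orth.frobSq_mul_transpose]
  conv_lhs => rw [h.eq]
  simp only [Matrix.mul_assoc]

theorem IsSVD.antitone_sq {p : ℕ} {A : Matrix ι κ ℝ} {U : Matrix ι (Fin p) ℝ}
    {σ : Fin p → ℝ} {V : Matrix κ (Fin p) ℝ} (h : IsSVD A U σ V) : Antitone fun i => σ i ^ 2 :=
  fun _ _ hij => pow_le_pow_left₀ (h.nonneg _) (h.decreasing hij) 2

theorem IsSVD.frobSq_eq {p : ℕ} {A : Matrix ι κ ℝ} {U : Matrix ι (Fin p) ℝ}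
    {σ : Fin p → ℝ} {V : Matrix κ (Fin p) ℝ} (h : IsSVD A U σ V) : frobSq A = ∑ j, σ j ^ 2 := by
  conv_lhs => rw [h.eq]
  rw [h.right_orth.frobSq_mul_transpose, h.left_orth.frobSq_mul, ← Matrix.one_mul
    (Matrix.diagonal σ), frobSq_mul_diagonal]
  refine Finset.sum_congr rfl fun j _ => ?_
  simp [Matrix.one_apply]

theorem IsSVD.frobSq_head {s m : ℕ} {A : Matrix ι κ ℝ} {U : Matrix ι (Fin (s + m)) ℝ}
    {σ : Fin (s + m) → ℝ} {V : Matrix κ (Fin (s + m)) ℝ} (h : IsSVD A U σ V) :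
    frobSq ((U.submatrix id (Fin.castAdd m))ᵀ * A) = ∑ i : Fin s, σ (Fin.castAdd m i) ^ 2 := by
  rw [h.frobSq_transpose_mul]
  have h1 : ∀ (a : Fin s) j, ((U.submatrix id (Fin.castAdd m))ᵀ * U) a j
      = if Fin.castAdd m a = j then 1 else 0 := fun a j => by
    rw [← h.left_orth.sum_mul]
    simp [Matrix.mul_apply]
  have h2 : ∀ j : Fin s, ∑ a : Fin s, (if Fin.castAdd m a = Fin.castAdd m j then (1 : ℝ) else 0) ^ 2
      = 1 := fun j => by simp
  have h3 : ∀ (j : Fin m) (a : Fin s), Fin.castAdd m a ≠ Fin.natAdd s j := fun j a => by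
    simp [Fin.ext_iff]; omega
  simp only [h1, Fin.sum_univ_add, h2, h3, if_false]
  simp

/-- The leading left singular vectors span a subspace that captures the largest possible part of
the Frobenius norm. -/
theorem IsTruncSVD.frobSq_proj_mul_le {s : ℕ} {A : Matrix ι κ ℝ} {U : Matrix ι (Fin s) ℝ}
    {S : Matrix (Fin s) (Fin s) ℝ} {V : Matrix κ (Fin s) ℝ} (h : IsTruncSVD A U S V)
    {W : Matrix ι (Fin s) ℝ} (hW : IsStiefel W) :
    frobSq (proj W * A) ≤ frobSq (proj U * A) := by
  rw [hW.frobSq_proj_mul, h.isStiefel_left.frobSq_proj_mul]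
  obtain ⟨p, hp, Uf, σ, Vf, hA, rfl, -, -⟩ := h
  obtain ⟨m, rfl⟩ := Nat.exists_eq_add_of_le hp
  rw [hA.frobSq_transpose_mul, show Fin.castLE hp = Fin.castAdd m from rfl, hA.frobSq_head]
  exact sum_mul_le_sum_head hA.antitone_sq (fun _ => sq_nonneg _)
    (fun _ => Finset.sum_nonneg fun _ _ => sq_nonneg _)
    (fun j => hW.sum_sq_transpose_mul_le_one hA.left_orth j)
    (hW.sum_sum_sq_transpose_mul_le hA.left_orth)

/-- The first `s` singular triplets of a matrix with columns in a `d`-dimensional space carry at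
least the fraction `s / d` of its squared Frobenius norm. -/
theorem IsTruncSVD.mul_frobSq_le {s d : ℕ} {A : Matrix ι κ ℝ} {U : Matrix ι (Fin s) ℝ}
    {S : Matrix (Fin s) (Fin s) ℝ} {V : Matrix κ (Fin s) ℝ} (h : IsTruncSVD A U S V)
    {E : Matrix ι (Fin d) ℝ} (hE : IsStiefel E) (hEA : E * Eᵀ * A = A) (hsd : s ≤ d) :
    s * frobSq A ≤ d * frobSq (proj U * A) := by
  rw [h.isStiefel_left.frobSq_proj_mul]
  obtain ⟨p, hp, Uf, σ, Vf, hA, rfl, -, -⟩ := h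
  obtain ⟨m, rfl⟩ := Nat.exists_eq_add_of_le hp
  rw [hA.frobSq_eq, show Fin.castLE hp = Fin.castAdd m from rfl, hA.frobSq_head]
  -- The weight of the `j`-th triplet is the squared length of the component of its left vector in
  -- the range of `E`. It equals `1` when `σ j ≠ 0`, since that vector then lies in the column space
  -- of `A`.
  refine mul_sum_le_mul_sum_head (w := fun j => ∑ a, (Eᵀ * Uf) a j ^ 2) hA.antitone_sq
    (fun _ => sq_nonneg _) (fun _ => Finset.sum_nonneg fun _ _ => sq_nonneg _) (fun j hj => ?_)
    (hE.sum_sum_sq_transpose_mul_le hA.left_orth) hsd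
  have hσ : σ j ≠ 0 := fun h0 => hj (by simp [h0])
  have hAV : A * Vf = Uf * Matrix.diagonal σ := by
    conv_lhs => rw [hA.eq]
    rw [Matrix.mul_assoc, show Vfᵀ * Vf = 1 from hA.right_orth, Matrix.mul_one]
  have h1 : E * (Eᵀ * Uf) * Matrix.diagonal σ = Uf * Matrix.diagonal σ := by
    rw [← Matrix.mul_assoc, Matrix.mul_assoc _ Uf, ← hAV, ← Matrix.mul_assoc, hEA]
  have h2 : ∀ i, (E * (Eᵀ * Uf)) i j = Uf i j := fun i => by
    have := congrFun (congrFun h1 i) j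
    rw [Matrix.mul_diagonal, Matrix.mul_diagonal] at this
    exact mul_right_cancel₀ hσ this
  have h3 : ∑ a, (Eᵀ * Uf) a j ^ 2 = ∑ i, Uf i j ^ 2 := by
    rw [← frobSq_col, ← frobSq_col, ← hE.frobSq_mul]
    congr 1
    ext i k
    rw [Matrix.submatrix_apply, id, ← h2 i]
    simp [Matrix.mul_apply]
  rw [h3]
  have := hA.left_orth.sum_mul j j
  simpa [sq] using this

/-- Spectral theorem for `AᵀA`: the images of its eigenvectors are orthogonal, with the eigenvalues
as squared lengths. The cardinality assumption leaves room for one left vector per eigenvector. -/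
theorem exists_isSVD_of_card_le (A : Matrix ι κ ℝ)
    (h : Fintype.card κ ≤ Fintype.card ι) :
    ∃ (U : Matrix ι (Fin (Fintype.card κ)) ℝ) (σ : Fin (Fintype.card κ) → ℝ)
      (V : Matrix κ (Fin (Fintype.card κ)) ℝ), IsSVD A U σ V := by
  classical
  set f : EuclideanSpace ℝ κ →ₗ[ℝ] EuclideanSpace ℝ ι := Matrix.toEuclideanLin A with hf
  have hT : (f.adjoint ∘ₗ f).IsSymmetric := fun x y => by
    rw [LinearMap.comp_apply, LinearMap.comp_apply, LinearMap.adjoint_inner_left,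
      LinearMap.adjoint_inner_right]
  have hn : Module.finrank ℝ (EuclideanSpace ℝ κ) = Fintype.card κ := finrank_euclideanSpace
  set v := hT.eigenvectorBasis hn with hv
  set l := hT.eigenvalues hn with hl
  have hin : ∀ i j, inner ℝ (f (v i)) (f (v j)) = if i = j then l i else 0 := by
    intro i j
    rw [← LinearMap.adjoint_inner_left, ← LinearMap.comp_apply, hT.apply_eigenvectorBasis hn i,
      inner_smul_left, orthonormal_iff_ite.1 v.orthonormal]
    simp [hl]
  have hl0 : ∀ i, 0 ≤ l i := fun i => by
    have := hin i i
    rw [if_pos rfl] at this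
    rw [← this]
    exact real_inner_self_nonneg
  obtain ⟨m, hm⟩ := Nat.exists_eq_add_of_le h
  set w : Fin (Fintype.card κ + m) → EuclideanSpace ℝ ι :=
    Fin.append (fun j => (√(l j))⁻¹ • f (v j)) 0 with hw
  -- Only indices with nonzero eigenvalue are prescribed; at the others any basis vector will do, as
  -- `f (v j) = 0` there.
  have hs : Orthonormal ℝ
      ((Fin.castAdd m '' {j | l j ≠ 0}).domRestrict w) := by
    rw [orthonormal_iff_ite]
    rintro ⟨_, i, hi, rfl⟩ ⟨_, j, hj, rfl⟩
    have hi' : √(l i) ≠ 0 := (Real.sqrt_pos.2 (lt_of_le_of_ne (hl0 i) (Ne.symm hi))).ne'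
    simp only [Set.domRestrict, hw, Fin.append_left, inner_smul_left, inner_smul_right, hin,
      Subtype.ext_iff, Fin.castAdd_inj, conj_trivial]
    split_ifs with hij
    · subst hij
      rw [← mul_assoc, ← mul_inv, Real.mul_self_sqrt (hl0 i), inv_mul_cancel₀ hi]
    · simp
  obtain ⟨b, hb⟩ := hs.exists_orthonormalBasis_extension_of_card_eq (by simp [hm])
  have hfv : ∀ j, f (v j) = √(l j) • b (Fin.castAdd m j) := by
    intro j
    by_cases hj : l j = 0
    · have := hin j j
      rw [if_pos rfl, hj, inner_self_eq_zero] at this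
      rw [this, hj]; simp
    · have hj' : √(l j) ≠ 0 := (Real.sqrt_pos.2 (lt_of_le_of_ne (hl0 j) (Ne.symm hj))).ne'
      rw [hb _ ⟨j, hj, rfl⟩, hw, Fin.append_left, smul_smul, mul_inv_cancel₀ hj', one_smul]
  set V : Matrix κ (Fin (Fintype.card κ)) ℝ := Matrix.of fun i j => v j i with hV
  have hVV : V * Vᵀ = 1 := by
    ext i j
    have := orthonormalBasis_sum_mul v i j
    simpa [hV, Matrix.mul_apply, Matrix.one_apply] using this
  refine ⟨Matrix.of fun i j => b (Fin.castAdd m j) i, fun j => √(l j), V,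
    isStiefel_of_orthonormal (b.orthonormal.comp _ (Fin.castAdd_injective _ _)),
    isStiefel_of_orthonormal v.orthonormal, fun _ => Real.sqrt_nonneg _,
    fun _ _ hij => Real.sqrt_le_sqrt (hT.eigenvalues_antitone hn hij), ?_⟩
  rw [← Matrix.mul_one A, ← hVV, ← Matrix.mul_assoc]
  congr 1
  ext i j
  have := congrArg (fun x : EuclideanSpace ℝ ι => x i) (hfv j)
  simp only [hf, PiLp.smul_apply, smul_eq_mul] at this
  rw [Matrix.mul_diagonal, Matrix.of_apply, mul_comm, ← this]
  simp [Matrix.mul_apply, hV, Matrix.toLpLin_apply, Matrix.mulVec, dotProduct]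

theorem exists_isTruncSVD (A : Matrix ι κ ℝ) {s : ℕ} (h1 : s ≤ Fintype.card ι)
    (h2 : s ≤ Fintype.card κ) : 
    ∃ (U : Matrix ι (Fin s) ℝ) (S : Matrix (Fin s) (Fin s) ℝ) (V : Matrix κ (Fin s) ℝ),
      IsTruncSVD A U S V := by
  rcases le_total (Fintype.card κ) (Fintype.card ι) with h | h
  · obtain ⟨U, σ, V, hA⟩ := exists_isSVD_of_card_le A h
    exact ⟨_, _, _, _, h2, U, σ, V, hA, rfl, rfl, rfl⟩
  · obtain ⟨U, σ, V, hA⟩ := exists_isSVD_of_card_le Aᵀ h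
    exact ⟨_, _, _, _, h1, V, σ, U, hA.transpose, rfl, rfl, rfl⟩

/-- The singular vectors of a matrix can be chosen in a given space containing its columns. -/
theorem exists_isTruncSVD_of_proj_mul_eq (A : Matrix ι κ ℝ) {s d : ℕ} {E : Matrix ι (Fin d) ℝ}
    (hE : IsStiefel E) (hEA : E * Eᵀ * A = A) (h1 : s ≤ d) (h2 : s ≤ Fintype.card κ) :
    ∃ (F : Matrix (Fin d) (Fin s) ℝ) (S : Matrix (Fin s) (Fin s) ℝ) (V : Matrix κ (Fin s) ℝ),
      IsTruncSVD A (E * F) S V := by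
  -- Decomposing the coordinates `Eᵀ A` and mapping the left vectors back by `E` keeps them in the
  -- range of `E`.
  obtain ⟨-, -, -, p, hp, Uf, σ, Vf, hA, -, -, -⟩ :=
    exists_isTruncSVD (Eᵀ * A) (s := s) (by simpa using h1) h2
  refine ⟨Uf.submatrix id (Fin.castLE hp), _, _, p, hp, E * Uf, σ, Vf,
    ⟨?_, hA.right_orth, hA.nonneg, hA.decreasing, ?_⟩, ?_, rfl, rfl⟩
  · have := hA.left_orth
    unfold IsStiefel at *
    rw [Matrix.transpose_mul, Matrix.mul_assoc, ← Matrix.mul_assoc Eᵀ, hE, Matrix.one_mul, this]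
  · rw [Matrix.mul_assoc, Matrix.mul_assoc, ← Matrix.mul_assoc Uf, ← hA.eq, ← Matrix.mul_assoc, hEA]
  · rfl

end SVD

/-! ## Orthogonal projectors -/

section Projectors

variable {E : Type*} [NormedAddCommGroup E] [InnerProductSpace ℝ E]

/-- Symmetric idempotents. -/
structure IsOrthProj (p : Module.End ℝ E) : Prop where
  idem : p * p = p
  symm : p.IsSymmetric

/-- Take adjoints on both sides. -/
theorem mul_eq_of_mul_eq {p q c : Module.End ℝ E} (hp : p.IsSymmetric) (hq : q.IsSymmetric)
    (hc : c.IsSymmetric) (h : p * q = c) : q * p = c := by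
  ext x
  refine ext_inner_right ℝ fun y => ?_
  rw [Module.End.mul_apply, hq, hp, hc, ← h, Module.End.mul_apply]

theorem IsOrthProj.mul {p q : Module.End ℝ E} (hp : IsOrthProj p) (hq : IsOrthProj q)
    (h : Commute p q) : IsOrthProj (p * q) where
  idem := by rw [mul_assoc, ← mul_assoc q, ← h.eq, mul_assoc p q q, hq.idem, ← mul_assoc, hp.idem]
  symm x y := by
    rw [Module.End.mul_apply, hp.symm, hq.symm, h.eq, Module.End.mul_apply]

theorem IsOrthProj.sub {p q : Module.End ℝ E} (hp : IsOrthProj p) (hq : IsOrthProj q)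
    (h : p * q = q) : IsOrthProj (p - q) where
  idem := by
    rw [sub_mul, mul_sub, mul_sub, hp.idem, h, mul_eq_of_mul_eq hp.symm hq.symm hq.symm h, hq.idem]
    abel
  symm := hp.symm.sub hq.symm

theorem IsOrthProj.one_sub {p : Module.End ℝ E} (hp : IsOrthProj p) : IsOrthProj (1 - p) :=
  IsOrthProj.sub ⟨mul_one 1, LinearMap.IsSymmetric.id⟩ hp (one_mul p)

theorem IsOrthProj.inner_self {p : Module.End ℝ E} (hp : IsOrthProj p) (x : E) :
    inner ℝ x (p x) = ‖p x‖ ^ 2 := by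
  rw [← real_inner_self_eq_norm_sq, hp.symm, ← Module.End.mul_apply, hp.idem]

theorem IsOrthProj.norm_sq_mul_le {p q : Module.End ℝ E} (hp : IsOrthProj p) (x : E) :
    ‖(p * q) x‖ ^ 2 ≤ ‖q x‖ ^ 2 := by
  rw [Module.End.mul_apply]
  have h := hp.inner_self (q x)
  have h2 := real_inner_le_norm (q x) (p (q x))
  rw [h] at h2
  have : ‖p (q x)‖ ≤ ‖q x‖ := by
    by_contra hlt
    push Not at hlt
    nlinarith [norm_nonneg (q x)]
  gcongr

/-- Projectors with the relations satisfied by the projectors onto the column space (`P`) and the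
row space (`R`) of the left unfolding, and onto the row space (`Q`) and the column space (`K`) of
the right unfolding of a tensor. -/
structure IsFrame (P Q R K : Module.End ℝ E) : Prop where
  projP : IsOrthProj P
  projQ : IsOrthProj Q
  projR : IsOrthProj R
  projK : IsOrthProj K
  commPQ : Commute P Q
  commPR : Commute P R
  commQK : Commute Q K
  QR : Q * R = R
  PK : P * K = K

/-- Projectors orthogonal to `P` and commuting with `Q` and `R`. -/
structure IsAdmissible (P Q R u : Module.End ℝ E) : Prop where
  proj : IsOrthProj u
  mul_eq_zero : P * u = 0
  commQ : Commute u Q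
  commR : Commute u R

/-- The projector onto a linear space contained in the tangent cone. -/
def frameProj (P Q R K u v : Module.End ℝ E) : Module.End ℝ E :=
  (1 - P) * R + K * (1 - Q) + P * Q + u * (Q - R) + v * (P - K) + u * v

variable {P Q R K u v : Module.End ℝ E}

theorem IsFrame.swap (h : IsFrame P Q R K) : IsFrame Q P K R :=
  ⟨h.projQ, h.projP, h.projK, h.projR, h.commPQ.symm, h.commQK, h.commPR, h.PK, h.QR⟩

theorem IsAdmissible.mul_eq_zero' (hu : IsAdmissible P Q R u) (h : IsFrame P Q R K) :
    u * P = 0 :=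
  mul_eq_of_mul_eq h.projP.symm hu.proj.symm LinearMap.IsSymmetric.zero hu.mul_eq_zero

theorem IsFrame.one_sub_admissible (h : IsFrame P Q R K) : IsAdmissible P Q R (1 - P) where
  proj := h.projP.one_sub
  mul_eq_zero := by rw [mul_sub, mul_one, h.projP.idem, sub_self]
  commQ := (Commute.one_left _).sub_left h.commPQ
  commR := (Commute.one_left _).sub_left h.commPR

theorem IsAdmissible.mul_one_sub (hu : IsAdmissible P Q R u) (h : IsFrame P Q R K) :
    u * (1 - P) = u := by
  rw [mul_sub, mul_one, hu.mul_eq_zero' h, sub_zero]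

theorem IsFrame.projQR (h : IsFrame P Q R K) : IsOrthProj (Q - R) := h.projQ.sub h.projR h.QR

theorem IsAdmissible.commQR (hu : IsAdmissible P Q R u) : Commute u (Q - R) :=
  hu.commQ.sub_right hu.commR

theorem frameProj_isSymmetric (h : IsFrame P Q R K) (hu : IsAdmissible P Q R u)
    (hv : IsAdmissible Q P K v) (huv : Commute u v) : (frameProj P Q R K u v).IsSymmetric := by
  refine LinearMap.IsSymmetric.add (.add (.add (.add (.add ?_ ?_) ?_) ?_) ?_) ?_
  · exact (h.projP.one_sub.mul h.projR ((Commute.one_left _).sub_left h.commPR)).symm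
  · exact (h.projK.mul h.projQ.one_sub ((Commute.one_right _).sub_right h.commQK.symm)).symm
  · exact (h.projP.mul h.projQ h.commPQ).symm
  · exact (hu.proj.mul h.projQR hu.commQR).symm
  · exact (hv.proj.mul h.swap.projQR hv.commQR).symm
  · exact (hu.proj.mul hv.proj huv).symm

/-- The complement splits into a left and a right defect. Consequently a vector on which both `(1 -
P - u) * (1 - R)` and `(1 - Q - v) * (1 - K)` vanish is fixed by `frameProj`. No product of `R` and
`K`, which need not commute, occurs. -/
theorem one_sub_frameProj (h : IsFrame P Q R K) (hu : IsAdmissible P Q R u)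
    (hv : IsAdmissible Q P K v) (huv : Commute u v) :
    1 - frameProj P Q R K u v =
      (1 - P - u) * (1 - R) + (P + u) * ((1 - Q - v) * (1 - K)) := by
  have huK : u * K = 0 := by rw [← h.PK, ← mul_assoc, hu.mul_eq_zero' h, zero_mul]
  have e1 : P * (Q * K) = K * Q := by rw [← mul_assoc, h.commPQ.eq, mul_assoc, h.PK, h.commQK.eq]
  have e2 : P * (v * K) = v * K := by rw [← mul_assoc, ← hv.commQ.eq, mul_assoc, h.PK]
  have e3 : u * (Q * K) = 0 := by rw [← mul_assoc, hu.commQ.eq, mul_assoc, huK, mul_zero]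
  have e4 : u * (v * K) = 0 := by rw [← mul_assoc, huv.eq, mul_assoc, huK, mul_zero]
  simp only [frameProj, mul_sub, sub_mul, add_mul, mul_one, one_mul, e1, e2, e3, e4, huK,
    h.PK, hv.commQ.eq]
  abel

theorem frameProj_apply_eq_self (h : IsFrame P Q R K) (hu : IsAdmissible P Q R u)
    (hv : IsAdmissible Q P K v) (huv : Commute u v) {z : E}
    (h1 : ((1 - P - u) * (1 - R)) z = 0) (h2 : ((1 - Q - v) * (1 - K)) z = 0) :
    frameProj P Q R K u v z = z := by
  have := congrArg (fun f : Module.End ℝ E => f z) (one_sub_frameProj h hu hv huv)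
  simp only [LinearMap.sub_apply, Module.End.one_apply, LinearMap.add_apply, h1,
    Module.End.mul_apply (P + u), h2, map_zero, add_zero] at this
  exact (sub_eq_zero.1 this).symm

/-- The factor `1 - P - u` annihilates every summand except `(1 - P) * R`, and `1 - R` removes what
is left of that one. -/
theorem mul_frameProj_left (h : IsFrame P Q R K) (hu : IsAdmissible P Q R u)
    (hv : IsAdmissible Q P K v) :
    (1 - P - u) * (1 - R) * frameProj P Q R K u v = 0 := by
  have hLP : (1 - P - u) * P = 0 := by
    rw [sub_mul, sub_mul, one_mul, h.projP.idem, hu.mul_eq_zero' h, sub_self, sub_zero]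
  have hLu : (1 - P - u) * u = 0 := by
    rw [sub_mul, sub_mul, one_mul, hu.proj.idem, hu.mul_eq_zero, sub_zero, sub_self]
  have hLR : Commute (1 - P - u) (1 - R) :=
    (Commute.one_right _).sub_right
      (((Commute.one_left _).sub_left h.commPR).sub_left hu.commR)
  have hLK : (1 - P - u) * K = 0 := by rw [← h.PK, ← mul_assoc, hLP, zero_mul]
  have hvPK : v * (P - K) = P * (v * (P - K)) := by
    rw [← mul_assoc, ← hv.commQ.eq, mul_assoc, mul_sub P, h.projP.idem, h.PK]
  have hL : (1 - P - u) * frameProj P Q R K u v = (1 - P - u) * R := by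
    rw [frameProj, hvPK]
    simp only [mul_add, ← mul_assoc, hLP, hLu, hLK, mul_sub (1 - P - u) 1 P, mul_one, zero_mul,
      sub_zero, add_zero]
  rw [hLR.eq, mul_assoc, hL, ← mul_assoc, ← hLR.eq, mul_assoc, sub_mul 1 R R, one_mul,
    h.projR.idem, sub_self, mul_zero]

/-- The left–right symmetry, through which each one-sided statement yields its mirror image. -/
theorem frameProj_swap (huv : Commute u v) (h : IsFrame P Q R K) :
    frameProj Q P K R v u = frameProj P Q R K u v := by
  simp only [frameProj, mul_sub, sub_mul, mul_one, one_mul, huv.eq, h.commPQ.eq, h.commPR.eq,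
    h.commQK.eq]
  abel

theorem frameProj_isOrthProj (h : IsFrame P Q R K) (hu : IsAdmissible P Q R u)
    (hv : IsAdmissible Q P K v) (huv : Commute u v) : IsOrthProj (frameProj P Q R K u v) where
  idem := by
    ext y
    rw [Module.End.mul_apply]
    -- Idempotence: vectors in the range satisfy both linear conditions, and such vectors are fixed.
    refine frameProj_apply_eq_self h hu hv huv ?_ ?_
    · rw [← Module.End.mul_apply, mul_frameProj_left h hu hv, LinearMap.zero_apply]
    · rw [← frameProj_swap huv h, ← Module.End.mul_apply, mul_frameProj_left h.swap hv hu,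
        LinearMap.zero_apply]
  symm := frameProj_isSymmetric h hu hv huv

/-- The part of `‖frameProj P Q R K u v y‖ ^ 2` that depends on `u` and `v`. -/
def gain (P Q R K u v : Module.End ℝ E) (y : E) : ℝ :=
  ‖(u * (Q - R)) y‖ ^ 2 + ‖(v * (P - K)) y‖ ^ 2 + ‖(u * v) y‖ ^ 2

/-- The operator and each of its six summands are orthogonal projectors, so `⟨y, p y⟩ = ‖p y‖²` for
all seven and the identity follows by additivity, without checking pairwise orthogonality. -/
theorem norm_sq_frameProj (h : IsFrame P Q R K) (hu : IsAdmissible P Q R u)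
    (hv : IsAdmissible Q P K v) (huv : Commute u v) (y : E) :
    ‖frameProj P Q R K u v y‖ ^ 2 = ‖((1 - P) * R) y‖ ^ 2 + ‖(K * (1 - Q)) y‖ ^ 2
      + ‖(P * Q) y‖ ^ 2 + gain P Q R K u v y := by
  rw [← (frameProj_isOrthProj h hu hv huv).inner_self, gain,
    ← (h.projP.one_sub.mul h.projR ((Commute.one_left _).sub_left h.commPR)).inner_self,
    ← (h.projK.mul h.projQ.one_sub ((Commute.one_right _).sub_right h.commQK.symm)).inner_self,
    ← (h.projP.mul h.projQ h.commPQ).inner_self,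
    ← (hu.proj.mul h.projQR hu.commQR).inner_self,
    ← (hv.proj.mul h.swap.projQR hv.commQR).inner_self,
    ← (hu.proj.mul hv.proj huv).inner_self]
  simp only [frameProj, LinearMap.add_apply, inner_add_right]
  ring

/-- An element of the range of `frameProj` that is the best approximation of `y` on the line that
it spans is not longer than the projection of `y`. -/
theorem norm_le_norm_frameProj (h : IsFrame P Q R K) (hu : IsAdmissible P Q R u)
    (hv : IsAdmissible Q P K v) (huv : Commute u v) {y z : E}
    (h1 : ((1 - P - u) * (1 - R)) z = 0) (h2 : ((1 - Q - v) * (1 - K)) z = 0)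
    (hz : inner ℝ y z = ‖z‖ ^ 2) : ‖z‖ ≤ ‖frameProj P Q R K u v y‖ := by
  have h3 : inner ℝ (frameProj P Q R K u v y) z = ‖z‖ ^ 2 := by
    rw [frameProj_isSymmetric h hu hv huv, frameProj_apply_eq_self h hu hv huv h1 h2, hz]
  have h4 := real_inner_le_norm (frameProj P Q R K u v y) z
  rw [h3] at h4
  by_contra hlt
  push Not at hlt
  nlinarith [norm_nonneg (frameProj P Q R K u v y)]

/-- The function maximized over `u` for given `v`. -/
def leftGain (Q R u v : Module.End ℝ E) (y : E) : ℝ :=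
  ‖(u * (Q - R)) y‖ ^ 2 + ‖(u * v) y‖ ^ 2

/-- The two parts of the matrix decomposed by the algorithm stay orthogonal under `u` because `v * Q
= 0` and `v * R = 0`. Thus the energy captured by an SVD is exactly `leftGain`. -/
theorem norm_sq_apply_add (h : IsFrame P Q R K) (hu : IsAdmissible P Q R u)
    (hv : IsAdmissible Q P K v) (huv : Commute u v) (y : E) :
    ‖u (v y + (Q - R) y)‖ ^ 2 = leftGain Q R u v y := by
  have hvQR : (u * v) * (u * (Q - R)) = 0 := by
    have hvR : v * R = 0 := by rw [← h.QR, ← mul_assoc, hv.mul_eq_zero' h.swap, zero_mul]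
    rw [hu.commQR.eq, huv.eq, mul_assoc, ← mul_assoc u, hu.commQR.eq, ← mul_assoc, ← mul_assoc,
      mul_sub, hv.mul_eq_zero' h.swap, hvR, sub_zero, zero_mul, zero_mul]
  have horth : inner ℝ ((u * v) y) ((u * (Q - R)) y) = 0 := by
    rw [(hu.proj.mul hv.proj huv).symm, ← Module.End.mul_apply, hvQR, LinearMap.zero_apply,
      inner_zero_right]
  rw [map_add, ← Module.End.mul_apply, ← Module.End.mul_apply, norm_add_sq_real, horth, leftGain]
  ring

theorem gain_eq_leftGain_add : gain P Q R K u v =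
    fun y => leftGain Q R u v y + ‖(v * (P - K)) y‖ ^ 2 := by
  ext y
  simp only [gain, leftGain]
  ring

theorem gain_swap (huv : Commute u v) (y : E) : gain Q P K R v u y = gain P Q R K u v y := by
  simp only [gain, huv.eq]
  ring

/-- Choosing `u` optimal for the full complement of `Q`, and then `v` good for this `u`, is good. -/
theorem mul_gain_le_of_choice (h : IsFrame P Q R K) {u₁ v₁ : Module.End ℝ E}
    (hv : IsAdmissible Q P K v) (huv : Commute u v)
    (huv₁ : Commute u₁ v₁) (hu₁ : IsAdmissible P Q R u₁) {y : E} {c : ℝ} (hc0 : 0 ≤ c) (hc1 : c ≤ 1)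
    (h1 : leftGain Q R u (1 - Q) y ≤ leftGain Q R u₁ (1 - Q) y)
    (h2 : c * leftGain P K (1 - Q) u₁ y ≤ leftGain P K v₁ u₁ y) :
    c * gain P Q R K u v y ≤ gain P Q R K u₁ v₁ y := by
  have hvQ : v * (1 - Q) = v := hv.mul_one_sub h.swap
  have e1 : ‖(v * (P - K)) y‖ ^ 2 ≤ ‖((1 - Q) * (P - K)) y‖ ^ 2 := by
    conv_lhs => rw [← hvQ, mul_assoc]
    exact hv.proj.norm_sq_mul_le y
  have e2 : ‖(u * v) y‖ ^ 2 ≤ ‖(u * (1 - Q)) y‖ ^ 2 := by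
    have : u * v = v * (u * (1 - Q)) := by
      rw [← mul_assoc, ← huv.eq, mul_assoc, hvQ]
    rw [this]
    exact hv.proj.norm_sq_mul_le y
  have e3 : (1 - Q) * u₁ = u₁ * (1 - Q) :=
    (((Commute.one_right _).sub_right hu₁.commQ).eq).symm
  have h0 : 0 ≤ ‖(u₁ * (Q - R)) y‖ ^ 2 := by positivity
  simp only [leftGain, e3, ← huv₁.eq] at h1 h2
  simp only [gain]
  -- Replacing `v` by `1 - Q` and then `u` by `u₁` only increases the gain. Of the three resulting
  -- terms, the two containing `1 - Q` are controlled by `h2`, and the third, `‖(u₁ * (Q - R)) y‖²`,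
  -- by `c ≤ 1`.
  nlinarith [mul_le_mul_of_nonneg_left e1 hc0, mul_le_mul_of_nonneg_left e2 hc0,
    mul_le_mul_of_nonneg_left h1 hc0, mul_le_mul_of_nonneg_right hc1 h0]

end Projectors

/-! ## Calculus of contractions and unfoldings -/

section Contractions

variable {a b c p q n1 n2 n3 : ℕ}

@[simp] theorem lUnf_lFold (M : Matrix (Fin a) (Fin b × Fin c) ℝ) : lUnf (lFold M) = M := rfl

@[simp] theorem rUnf_rFold (M : Matrix (Fin a × Fin b) (Fin c) ℝ) : rUnf (rFold M) = M := rfl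

@[simp] theorem lFold_lUnf (T : Tensor a b c) : lFold (lUnf T) = T := rfl

@[simp] theorem rFold_rUnf (T : Tensor a b c) : rFold (rUnf T) = T := rfl

theorem lUnf_injective : Function.Injective (lUnf : Tensor a b c → _) :=
  Function.LeftInverse.injective lFold_lUnf

theorem rUnf_injective : Function.Injective (rUnf : Tensor a b c → _) :=
  Function.LeftInverse.injective rFold_rUnf

@[simp] theorem lUnf_add (S T : Tensor a b c) : lUnf (S + T) = lUnf S + lUnf T := rfl

@[simp] theorem rUnf_add (S T : Tensor a b c) : rUnf (S + T) = rUnf S + rUnf T := rfl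

@[simp] theorem lUnf_sub (S T : Tensor a b c) : lUnf (S - T) = lUnf S - lUnf T := rfl

@[simp] theorem rUnf_sub (S T : Tensor a b c) : rUnf (S - T) = rUnf S - rUnf T := rfl

@[simp] theorem lUnf_smul (t : ℝ) (T : Tensor a b c) : lUnf (t • T) = t • lUnf T := rfl

@[simp] theorem rUnf_smul (t : ℝ) (T : Tensor a b c) : rUnf (t • T) = t • rUnf T := rfl

@[simp] theorem lUnf_lmul (M : Matrix (Fin p) (Fin a) ℝ) (T : Tensor a b c) :
    lUnf (lmul M T) = M * lUnf T := rfl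

@[simp] theorem rUnf_rmul (T : Tensor a b c) (M : Matrix (Fin c) (Fin q) ℝ) :
    rUnf (rmul T M) = rUnf T * M := rfl

theorem lmul_lmul (M : Matrix (Fin p) (Fin q) ℝ) (N : Matrix (Fin q) (Fin a) ℝ)
    (T : Tensor a b c) : lmul M (lmul N T) = lmul (M * N) T :=
  lUnf_injective (by simp [Matrix.mul_assoc])

theorem rmul_rmul (T : Tensor a b c) (M : Matrix (Fin c) (Fin q) ℝ)
    (N : Matrix (Fin q) (Fin p) ℝ) : rmul (rmul T M) N = rmul T (M * N) :=
  rUnf_injective (by simp [Matrix.mul_assoc])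

theorem rmul_lmul (M : Matrix (Fin p) (Fin a) ℝ) (T : Tensor a b c)
    (N : Matrix (Fin c) (Fin q) ℝ) : rmul (lmul M T) N = lmul M (rmul T N) := by
  ext x
  simp only [lmul, rmul, Finset.sum_mul, Finset.mul_sum]
  rw [Finset.sum_comm]
  exact Finset.sum_congr rfl fun _ _ => Finset.sum_congr rfl fun _ _ => mul_assoc _ _ _

theorem lmul_one (T : Tensor a b c) : lmul 1 T = T := lUnf_injective (by simp)

theorem rmul_one (T : Tensor a b c) : rmul T 1 = T := rUnf_injective (by simp)

theorem lmul_add (M : Matrix (Fin p) (Fin a) ℝ) (S T : Tensor a b c) :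
    lmul M (S + T) = lmul M S + lmul M T := lUnf_injective (by simp [Matrix.mul_add])

theorem lmul_sub (M : Matrix (Fin p) (Fin a) ℝ) (S T : Tensor a b c) :
    lmul M (S - T) = lmul M S - lmul M T := lUnf_injective (by simp [Matrix.mul_sub])

theorem lmul_smul (M : Matrix (Fin p) (Fin a) ℝ) (t : ℝ) (T : Tensor a b c) :
    lmul M (t • T) = t • lmul M T := lUnf_injective (by simp)

theorem add_lmul (M N : Matrix (Fin p) (Fin a) ℝ) (T : Tensor a b c) :
    lmul (M + N) T = lmul M T + lmul N T := lUnf_injective (by simp [Matrix.add_mul])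

theorem smul_lmul (t : ℝ) (M : Matrix (Fin p) (Fin a) ℝ) (T : Tensor a b c) :
    lmul (t • M) T = t • lmul M T := lUnf_injective (by simp)

theorem add_rmul (S T : Tensor a b c) (M : Matrix (Fin c) (Fin q) ℝ) :
    rmul (S + T) M = rmul S M + rmul T M := rUnf_injective (by simp [Matrix.add_mul])

theorem sub_rmul (S T : Tensor a b c) (M : Matrix (Fin c) (Fin q) ℝ) :
    rmul (S - T) M = rmul S M - rmul T M := rUnf_injective (by simp [Matrix.sub_mul])

theorem smul_rmul (t : ℝ) (T : Tensor a b c) (M : Matrix (Fin c) (Fin q) ℝ) :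
    rmul (t • T) M = t • rmul T M := rUnf_injective (by simp)

theorem rmul_add (T : Tensor a b c) (M N : Matrix (Fin c) (Fin q) ℝ) :
    rmul T (M + N) = rmul T M + rmul T N := rUnf_injective (by simp [Matrix.mul_add])

theorem rmul_smul (t : ℝ) (T : Tensor a b c) (M : Matrix (Fin c) (Fin q) ℝ) :
    rmul T (t • M) = t • rmul T M := rUnf_injective (by simp)

/-- Contractions of the third mode can be moved between the factors of `S^L (T^L)ᵀ`. -/
theorem lUnf_rmul_mul_transpose (S : Tensor a b c) (M : Matrix (Fin c) (Fin q) ℝ)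
    (T : Tensor p b q) :
    lUnf (rmul S M) * (lUnf T)ᵀ = lUnf S * (lUnf (rmul T Mᵀ))ᵀ := by
  ext i j
  simp only [Matrix.mul_apply, lUnf, rmul, Matrix.of_apply, Matrix.transpose_apply,
    Fintype.sum_prod_type, Finset.sum_mul, Finset.mul_sum]
  refine Finset.sum_congr rfl fun x _ => ?_
  rw [Finset.sum_comm]
  exact Finset.sum_congr rfl fun _ _ => Finset.sum_congr rfl fun _ _ => by ring

/-- Contractions of the first mode can be moved between the factors of `(T^R)ᵀ S^R`. -/
theorem transpose_mul_rUnf_lmul (S : Tensor a b c) (M : Matrix (Fin q) (Fin a) ℝ)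
    (T : Tensor q b p) :
    (rUnf T)ᵀ * rUnf (lmul M S) = (rUnf (lmul Mᵀ T))ᵀ * rUnf S := by
  ext i j
  simp only [Matrix.mul_apply, rUnf, lmul, Matrix.of_apply, Matrix.transpose_apply,
    Fintype.sum_prod_type, Finset.sum_mul, Finset.mul_sum]
  rw [Finset.sum_comm]
  conv_rhs => rw [Finset.sum_comm]
  refine Finset.sum_congr rfl fun x _ => ?_
  rw [Finset.sum_comm]
  exact Finset.sum_congr rfl fun _ _ => Finset.sum_congr rfl fun _ _ => by ring

theorem inner_eq_trace_lUnf (S T : Tensor a b c) :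
    inner ℝ S T = ((lUnf S)ᵀ * lUnf T).trace := by
  simp only [PiLp.inner_apply, RCLike.inner_apply, conj_trivial, Matrix.trace, Matrix.diag,
    Matrix.mul_apply, Matrix.transpose_apply, lUnf, Matrix.of_apply]
  rw [Finset.sum_comm, Fintype.sum_prod_type]
  exact Finset.sum_congr rfl fun _ _ => Finset.sum_congr rfl fun _ _ => mul_comm _ _

theorem inner_eq_trace_rUnf (S T : Tensor a b c) :
    inner ℝ S T = ((rUnf S)ᵀ * rUnf T).trace := by
  simp only [PiLp.inner_apply, RCLike.inner_apply, conj_trivial, Matrix.trace, Matrix.diag,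
    Matrix.mul_apply, Matrix.transpose_apply, rUnf, Matrix.of_apply]
  rw [Finset.sum_comm]
  simp only [Fintype.sum_prod_type, mul_comm]

theorem frobSq_lUnf (T : Tensor a b c) : frobSq (lUnf T) = ‖T‖ ^ 2 := by
  rw [frobSq_eq_trace, ← inner_eq_trace_lUnf, real_inner_self_eq_norm_sq]

theorem frobSq_rUnf (T : Tensor a b c) : frobSq (rUnf T) = ‖T‖ ^ 2 := by
  rw [frobSq_eq_trace, ← inner_eq_trace_rUnf, real_inner_self_eq_norm_sq]

/-! ## Linear operators on tensors induced by square matrices -/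

/-- `T ↦ M · T`. -/
def leftOp (M : Matrix (Fin n1) (Fin n1) ℝ) : Module.End ℝ (Tensor n1 n2 n3) where
  toFun T := lmul M T
  map_add' := lmul_add M
  map_smul' := lmul_smul M

/-- `T ↦ T · M`. -/
def rightOp (M : Matrix (Fin n3) (Fin n3) ℝ) : Module.End ℝ (Tensor n1 n2 n3) where
  toFun T := rmul T M
  map_add' S T := add_rmul S T M
  map_smul' t T := smul_rmul t T M

/-- `T ↦ [T^L N]`. -/
def rowOp (N : Matrix (Fin n2 × Fin n3) (Fin n2 × Fin n3) ℝ) :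
    Module.End ℝ (Tensor n1 n2 n3) where
  toFun T := lFold (lUnf T * N)
  map_add' S T := lUnf_injective (by simp [Matrix.add_mul])
  map_smul' t T := lUnf_injective (by simp)

/-- `T ↦ [N T^R]`. -/
def colOp (N : Matrix (Fin n1 × Fin n2) (Fin n1 × Fin n2) ℝ) :
    Module.End ℝ (Tensor n1 n2 n3) where
  toFun T := rFold (N * rUnf T)
  map_add' S T := rUnf_injective (by simp [Matrix.mul_add])
  map_smul' t T := rUnf_injective (by simp)

theorem leftOp_apply (M : Matrix (Fin n1) (Fin n1) ℝ) (T : Tensor n1 n2 n3) :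
    leftOp M T = lmul M T := rfl

theorem rightOp_apply (M : Matrix (Fin n3) (Fin n3) ℝ) (T : Tensor n1 n2 n3) :
    rightOp M T = rmul T M := rfl

theorem rowOp_apply (N : Matrix (Fin n2 × Fin n3) (Fin n2 × Fin n3) ℝ) (T : Tensor n1 n2 n3) :
    rowOp N T = lFold (lUnf T * N) := rfl

theorem colOp_apply (N : Matrix (Fin n1 × Fin n2) (Fin n1 × Fin n2) ℝ) (T : Tensor n1 n2 n3) :
    colOp N T = rFold (N * rUnf T) := rfl

theorem leftOp_mul (M N : Matrix (Fin n1) (Fin n1) ℝ) :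
    (leftOp M * leftOp N : Module.End ℝ (Tensor n1 n2 n3)) = leftOp (M * N) :=
  LinearMap.ext fun T => lmul_lmul M N T

theorem rightOp_mul (M N : Matrix (Fin n3) (Fin n3) ℝ) :
    (rightOp M * rightOp N : Module.End ℝ (Tensor n1 n2 n3)) = rightOp (N * M) :=
  LinearMap.ext fun T => rmul_rmul T N M

theorem leftOp_one_sub (M : Matrix (Fin n1) (Fin n1) ℝ) :
    (leftOp (1 - M) : Module.End ℝ (Tensor n1 n2 n3)) = 1 - leftOp M :=
  LinearMap.ext fun T => lUnf_injective (by simp [leftOp, Matrix.sub_mul])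

theorem rightOp_one_sub (M : Matrix (Fin n3) (Fin n3) ℝ) :
    (rightOp (1 - M) : Module.End ℝ (Tensor n1 n2 n3)) = 1 - rightOp M :=
  LinearMap.ext fun T => rUnf_injective (by simp [rightOp, Matrix.mul_sub])

theorem commute_leftOp_rightOp (M : Matrix (Fin n1) (Fin n1) ℝ) (N : Matrix (Fin n3) (Fin n3) ℝ) :
    Commute (leftOp M : Module.End ℝ (Tensor n1 n2 n3)) (rightOp N) :=
  LinearMap.ext fun T => (rmul_lmul M T N).symm

theorem commute_leftOp_rowOp (M : Matrix (Fin n1) (Fin n1) ℝ)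
    (N : Matrix (Fin n2 × Fin n3) (Fin n2 × Fin n3) ℝ) :
    Commute (leftOp M : Module.End ℝ (Tensor n1 n2 n3)) (rowOp N) :=
  LinearMap.ext fun T => lUnf_injective (by simp [leftOp, rowOp, Matrix.mul_assoc])

theorem commute_rightOp_colOp (M : Matrix (Fin n3) (Fin n3) ℝ)
    (N : Matrix (Fin n1 × Fin n2) (Fin n1 × Fin n2) ℝ) :
    Commute (rightOp M : Module.End ℝ (Tensor n1 n2 n3)) (colOp N) :=
  LinearMap.ext fun T => rUnf_injective (by simp [rightOp, colOp, Matrix.mul_assoc])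

theorem isOrthProj_leftOp {M : Matrix (Fin n1) (Fin n1) ℝ} (hM : Mᵀ = M) (hMM : M * M = M) :
    IsOrthProj (leftOp M : Module.End ℝ (Tensor n1 n2 n3)) where
  idem := by rw [leftOp_mul, hMM]
  symm S T := by
    simp only [leftOp_apply, inner_eq_trace_lUnf, lUnf_lmul, Matrix.transpose_mul, hM,
      Matrix.mul_assoc]

theorem isOrthProj_rightOp {M : Matrix (Fin n3) (Fin n3) ℝ} (hM : Mᵀ = M) (hMM : M * M = M) :
    IsOrthProj (rightOp M : Module.End ℝ (Tensor n1 n2 n3)) where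
  idem := by rw [rightOp_mul, hMM]
  symm S T := by
    simp only [rightOp_apply, inner_eq_trace_rUnf, rUnf_rmul, Matrix.transpose_mul, hM]
    rw [Matrix.mul_assoc, Matrix.trace_mul_comm, Matrix.mul_assoc]

theorem isOrthProj_rowOp {N : Matrix (Fin n2 × Fin n3) (Fin n2 × Fin n3) ℝ} (hN : Nᵀ = N)
    (hNN : N * N = N) : IsOrthProj (rowOp N : Module.End ℝ (Tensor n1 n2 n3)) where
  idem := LinearMap.ext fun T => lUnf_injective (by simp [rowOp, Matrix.mul_assoc, hNN])
  symm S T := by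
    simp only [rowOp_apply, inner_eq_trace_lUnf, lUnf_lFold, Matrix.transpose_mul, hN]
    rw [Matrix.mul_assoc, Matrix.trace_mul_comm, Matrix.mul_assoc]

theorem isOrthProj_colOp {N : Matrix (Fin n1 × Fin n2) (Fin n1 × Fin n2) ℝ} (hN : Nᵀ = N)
    (hNN : N * N = N) : IsOrthProj (colOp N : Module.End ℝ (Tensor n1 n2 n3)) where
  idem := LinearMap.ext fun T => rUnf_injective (by
    simp [colOp, ← Matrix.mul_assoc, hNN])
  symm S T := by
    simp only [colOp_apply, inner_eq_trace_rUnf, rUnf_rFold, Matrix.transpose_mul, hN,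
      Matrix.mul_assoc]

end Contractions

/-! ### Projector matrices -/

section ProjMatrix

variable {ι κ : Type*} [Fintype κ]

theorem transpose_proj (U : Matrix ι κ ℝ) : (proj U)ᵀ = proj U := by
  simp [proj]

theorem transpose_perp [DecidableEq ι] (U : Matrix ι κ ℝ) : (perp U)ᵀ = perp U := by
  simp [perp]

theorem perp_eq [DecidableEq ι] (U : Matrix ι κ ℝ) : perp U = 1 - proj U := rfl

variable [Fintype ι]

theorem IsStiefel.proj_mul_self {p : ℕ} {U : Matrix ι (Fin p) ℝ} (hU : IsStiefel U) :
    proj U * U = U := by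
  rw [proj, Matrix.mul_assoc, show Uᵀ * U = 1 from hU, Matrix.mul_one]

theorem IsStiefel.proj_mul_proj {p : ℕ} {U : Matrix ι (Fin p) ℝ} (hU : IsStiefel U) :
    proj U * proj U = proj U := by
  change proj U * (U * Uᵀ) = U * Uᵀ
  rw [← Matrix.mul_assoc, hU.proj_mul_self]

theorem IsStiefel.proj_perp [DecidableEq ι] {p : ℕ} {U : Matrix ι (Fin p) ℝ} (hU : IsStiefel U) :
    proj (perp U) = perp U := by
  rw [proj, transpose_perp, perp_eq, mul_sub, sub_mul, one_mul, mul_one, sub_mul, one_mul,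
    hU.proj_mul_proj]
  abel

end ProjMatrix

/-! ## The projectors attached to the orthogonal decompositions -/

section Frame

variable {n1 n2 n3 r1 r2 s1 s2 : ℕ} {X : Tensor n1 n2 n3}

/-- The tensor `X2'' · X3''`, whose left unfolding has orthonormal rows. -/
def OrthTT.rowTensor (D : OrthTT X r1 r2) : Tensor r1 n2 n3 := rmul D.X2pp D.X3pp

/-- The tensor `X1' · X2'`, whose right unfolding has orthonormal columns. -/
def OrthTT.colTensor (D : OrthTT X r1 r2) : Tensor n1 n2 r2 := lmul D.X1p D.X2p

def OrthTT.P (D : OrthTT X r1 r2) : Module.End ℝ (Tensor n1 n2 n3) := leftOp (proj D.X1p)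

def OrthTT.Q (D : OrthTT X r1 r2) : Module.End ℝ (Tensor n1 n2 n3) := rightOp (proj D.X3ppᵀ)

def OrthTT.R (D : OrthTT X r1 r2) : Module.End ℝ (Tensor n1 n2 n3) :=
  rowOp (proj (lUnf D.rowTensor)ᵀ)

def OrthTT.K (D : OrthTT X r1 r2) : Module.End ℝ (Tensor n1 n2 n3) :=
  colOp (proj (rUnf D.colTensor))

theorem OrthTT.X3pp_mul (D : OrthTT X r1 r2) : D.X3pp * D.X3ppᵀ = 1 := D.orth_X3pp

theorem OrthTT.X1p_mul (D : OrthTT X r1 r2) : D.X1pᵀ * D.X1p = 1 := D.orth_X1p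

theorem OrthTT.isStiefel_rowTensor (D : OrthTT X r1 r2) : IsStiefel (lUnf D.rowTensor)ᵀ := by
  rw [IsStiefel, Matrix.transpose_transpose, OrthTT.rowTensor, lUnf_rmul_mul_transpose, rmul_rmul,
    D.X3pp_mul, rmul_one]
  exact D.orth_X2pp

theorem OrthTT.isStiefel_colTensor (D : OrthTT X r1 r2) : IsStiefel (rUnf D.colTensor) := by
  rw [IsStiefel, OrthTT.colTensor, transpose_mul_rUnf_lmul, lmul_lmul,
    D.X1p_mul, lmul_one]
  exact D.orth_X2p

theorem OrthTT.R_apply (D : OrthTT X r1 r2) (T : Tensor n1 n2 n3) :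
    D.R T = lmul (lUnf T * (lUnf D.rowTensor)ᵀ) D.rowTensor :=
  lUnf_injective (by
    simp only [OrthTT.R, rowOp_apply, lUnf_lFold, lUnf_lmul, proj, Matrix.transpose_transpose,
      Matrix.mul_assoc])

theorem OrthTT.K_apply (D : OrthTT X r1 r2) (T : Tensor n1 n2 n3) :
    D.K T = rmul D.colTensor ((rUnf D.colTensor)ᵀ * rUnf T) :=
  rUnf_injective (by
    simp only [OrthTT.K, colOp_apply, rUnf_rFold, rUnf_rmul, proj, Matrix.mul_assoc])

theorem OrthTT.isFrame (D : OrthTT X r1 r2) : IsFrame D.P D.Q D.R D.K where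
  projP := isOrthProj_leftOp (transpose_proj _) D.orth_X1p.proj_mul_proj
  projQ := isOrthProj_rightOp (transpose_proj _) D.orth_X3pp.proj_mul_proj
  projR := isOrthProj_rowOp (transpose_proj _) D.isStiefel_rowTensor.proj_mul_proj
  projK := isOrthProj_colOp (transpose_proj _) D.isStiefel_colTensor.proj_mul_proj
  commPQ := commute_leftOp_rightOp _ _
  commPR := commute_leftOp_rowOp _ _
  commQK := commute_rightOp_colOp _ _
  QR := LinearMap.ext fun T => by
    rw [Module.End.mul_apply, D.R_apply, OrthTT.Q, rightOp_apply, rmul_lmul]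
    congr 1
    rw [OrthTT.rowTensor, rmul_rmul, proj, Matrix.transpose_transpose, ← Matrix.mul_assoc,
      D.X3pp_mul, Matrix.one_mul]
  PK := LinearMap.ext fun T => by
    rw [Module.End.mul_apply, D.K_apply, OrthTT.P, leftOp_apply, ← rmul_lmul]
    congr 1
    rw [OrthTT.colTensor, lmul_lmul, proj, Matrix.mul_assoc, D.X1p_mul, Matrix.mul_one]

theorem OrthTT.isAdmissible_leftOp (D : OrthTT X r1 r2) {U1 : Matrix (Fin n1) (Fin s1) ℝ}
    (hU : IsStiefel U1) (hUX : U1ᵀ * D.X1p = 0) :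
    IsAdmissible D.P D.Q D.R (leftOp (proj U1)) where
  proj := isOrthProj_leftOp (transpose_proj _) hU.proj_mul_proj
  mul_eq_zero := by
    have h : D.X1pᵀ * U1 = 0 := by
      rw [← Matrix.transpose_transpose U1, ← Matrix.transpose_mul, hUX, Matrix.transpose_zero]
    rw [OrthTT.P, leftOp_mul, proj, proj, Matrix.mul_assoc, ← Matrix.mul_assoc _ U1, h,
      Matrix.zero_mul, Matrix.mul_zero]
    exact LinearMap.ext fun T => lUnf_injective (by rw [leftOp_apply, lUnf_lmul, Matrix.zero_mul]; rfl)
  commQ := commute_leftOp_rightOp _ _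
  commR := commute_leftOp_rowOp _ _

theorem OrthTT.isAdmissible_rightOp (D : OrthTT X r1 r2) {V3 : Matrix (Fin s2) (Fin n3) ℝ}
    (hV : IsStiefel V3ᵀ) (hVX : V3 * D.X3ppᵀ = 0) :
    IsAdmissible D.Q D.P D.K (rightOp (proj V3ᵀ)) where
  proj := isOrthProj_rightOp (transpose_proj _) hV.proj_mul_proj
  mul_eq_zero := by
    rw [OrthTT.Q, rightOp_mul, proj, proj, Matrix.transpose_transpose, Matrix.transpose_transpose,
      Matrix.mul_assoc, ← Matrix.mul_assoc V3, hVX, Matrix.zero_mul, Matrix.mul_zero]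
    exact LinearMap.ext fun T => rUnf_injective (by rw [rightOp_apply, rUnf_rmul, Matrix.mul_zero]; rfl)
  commQ := (commute_leftOp_rightOp _ _).symm
  commR := commute_rightOp_colOp _ _

/-- Since `R` projects onto part of the range of `Q`, removing the row space of `X2pp` inside the
coordinates of `X3pp` is the projector `Q - R`. -/
theorem OrthTT.rmul_leftRest (D : OrthTT X r1 r2) (Y : Tensor n1 n2 n3) :
    rmul (leftRest D Y) D.X3pp = (D.Q - D.R) Y := by
  have h : leftRest D Y = rmul Y D.X3ppᵀ
      - lmul (lUnf (rmul Y D.X3ppᵀ) * (lUnf D.X2pp)ᵀ) D.X2pp :=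
    lUnf_injective (by
      simp only [leftRest, lUnf_lFold, lUnf_sub, lUnf_lmul, perp, Matrix.mul_sub, Matrix.mul_one,
        Matrix.transpose_transpose, Matrix.mul_assoc])
  rw [h, sub_rmul, rmul_rmul, rmul_lmul, lUnf_rmul_mul_transpose, Matrix.transpose_transpose,
    LinearMap.sub_apply, D.R_apply, OrthTT.Q, rightOp_apply, proj, Matrix.transpose_transpose]
  rfl

theorem OrthTT.lmul_rightRest (D : OrthTT X r1 r2) (Y : Tensor n1 n2 n3) :
    lmul D.X1p (rightRest D Y) = (D.P - D.K) Y := by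
  have h : rightRest D Y = lmul D.X1pᵀ Y
      - rmul D.X2p ((rUnf D.X2p)ᵀ * rUnf (lmul D.X1pᵀ Y)) :=
    rUnf_injective (by
      simp only [rightRest, rUnf_rFold, rUnf_sub, rUnf_rmul, perp, Matrix.sub_mul, Matrix.one_mul,
        Matrix.mul_assoc])
  rw [h, lmul_sub, lmul_lmul, ← rmul_lmul, transpose_mul_rUnf_lmul, Matrix.transpose_transpose,
    LinearMap.sub_apply, D.K_apply, OrthTT.P, leftOp_apply, proj]
  rfl

/-- The six tensor trains are, in this order, the six summands of `frameProj`. -/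
theorem OrthTT.assemble_eq (D : OrthTT X r1 r2) (Y : Tensor n1 n2 n3)
    (U1 : Matrix (Fin n1) (Fin s1) ℝ) (V3 : Matrix (Fin s2) (Fin n3) ℝ) :
    assemble D Y U1 V3
      = frameProj D.P D.Q D.R D.K (leftOp (proj U1)) (rightOp (proj V3ᵀ)) Y := by
  have e1 : lmul (paramW1 D Y) (rmul D.X2pp D.X3pp) = ((1 - D.P) * D.R) Y := by
    rw [paramW1, Matrix.mul_assoc, lUnf_rmul_mul_transpose, Matrix.transpose_transpose,
      Module.End.mul_apply, D.R_apply, OrthTT.P, ← leftOp_one_sub, leftOp_apply, lmul_lmul]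
    rfl
  have e2 : lmul D.X1p (rmul D.X2p (paramW3 D Y)) = (D.K * (1 - D.Q)) Y := by
    rw [((Commute.one_right D.K).sub_right D.isFrame.commQK.symm).eq, paramW3, transpose_mul_rUnf_lmul,
      Matrix.transpose_transpose, Module.End.mul_apply, D.K_apply, OrthTT.Q, ← rightOp_one_sub,
      rightOp_apply, rmul_rmul, ← rmul_lmul]
    rfl
  have e3 : lmul D.X1p (rmul (paramW2 D Y) D.X3pp) = (D.P * D.Q) Y := by
    rw [paramW2, rmul_lmul, lmul_lmul, rmul_rmul, Module.End.mul_apply, OrthTT.P, OrthTT.Q,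
      leftOp_apply, rightOp_apply, proj, proj, Matrix.transpose_transpose]
  have e4 : lmul U1 (rmul (paramV2 D Y U1) D.X3pp)
      = ((leftOp (proj U1) : Module.End ℝ (Tensor n1 n2 n3)) * (D.Q - D.R)) Y := by
    rw [paramV2, rmul_lmul, lmul_lmul, D.rmul_leftRest]
    rfl
  have e5 : lmul D.X1p (rmul (paramU2 D Y V3) V3)
      = ((rightOp (proj V3ᵀ) : Module.End ℝ (Tensor n1 n2 n3)) * (D.P - D.K)) Y := by
    rw [paramU2, rmul_rmul, ← rmul_lmul, D.lmul_rightRest, Module.End.mul_apply, rightOp_apply,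
      proj, Matrix.transpose_transpose]
  have e6 : lmul U1 (rmul (paramZ2 Y U1 V3) V3)
      = ((leftOp (proj U1) : Module.End ℝ (Tensor n1 n2 n3)) * (rightOp (proj V3ᵀ) : Module.End ℝ (Tensor n1 n2 n3))) Y := by
    rw [paramZ2, rmul_lmul, lmul_lmul, rmul_rmul, Module.End.mul_apply, leftOp_apply,
      rightOp_apply, proj, proj, Matrix.transpose_transpose]
  rw [assemble, e1, e2, e3, e4, e5, e6]
  rfl

/-! ## One step of the alternating algorithm -/

theorem OrthTT.leftMat_eq {q : ℕ} (D : OrthTT X r1 r2) (Y : Tensor n1 n2 n3)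
    (V3 : Matrix (Fin q) (Fin n3) ℝ) :
    leftMat D Y V3 = lUnf ((1 - D.P) (rightOp (proj V3ᵀ) Y + (D.Q - D.R) Y)) := by
  rw [leftMat, D.rmul_leftRest, ← lUnf_add, OrthTT.P, ← leftOp_one_sub]
  rfl

theorem OrthTT.rightMat_eq {p : ℕ} (D : OrthTT X r1 r2) (Y : Tensor n1 n2 n3)
    (U1 : Matrix (Fin n1) (Fin p) ℝ) :
    rightMat D Y U1 = rUnf ((1 - D.Q) (leftOp (proj U1) Y + (D.P - D.K) Y)) := by
  rw [rightMat, D.lmul_rightRest, ← rUnf_add, OrthTT.Q, ← rightOp_one_sub]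
  rfl

theorem OrthTT.frobSq_proj_mul_leftMat {q p : ℕ} (D : OrthTT X r1 r2) (Y : Tensor n1 n2 n3)
    {V3 : Matrix (Fin q) (Fin n3) ℝ} (hV : IsAdmissible D.Q D.P D.K (rightOp (proj V3ᵀ)))
    {U : Matrix (Fin n1) (Fin p) ℝ} (hU : IsAdmissible D.P D.Q D.R (leftOp (proj U))) :
    frobSq (proj U * leftMat D Y V3)
      = leftGain D.Q D.R (leftOp (proj U)) (rightOp (proj V3ᵀ)) Y := by
  rw [D.leftMat_eq, ← lUnf_lmul, frobSq_lUnf, ← leftOp_apply, ← Module.End.mul_apply,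
    hU.mul_one_sub D.isFrame,
    norm_sq_apply_add D.isFrame hU hV (commute_leftOp_rightOp _ _)]

theorem OrthTT.frobSq_rightMat_mul_proj {q p : ℕ} (D : OrthTT X r1 r2) (Y : Tensor n1 n2 n3)
    {U1 : Matrix (Fin n1) (Fin p) ℝ} (hU : IsAdmissible D.P D.Q D.R (leftOp (proj U1)))
    {V : Matrix (Fin q) (Fin n3) ℝ} (hV : IsAdmissible D.Q D.P D.K (rightOp (proj Vᵀ))) :
    frobSq (rightMat D Y U1 * proj Vᵀ)
      = leftGain D.P D.K (rightOp (proj Vᵀ)) (leftOp (proj U1)) Y := by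
  rw [D.rightMat_eq, ← rUnf_rmul, frobSq_rUnf, ← rightOp_apply, ← Module.End.mul_apply,
    hV.mul_one_sub D.isFrame.swap,
    norm_sq_apply_add D.isFrame.swap hV hU (commute_leftOp_rightOp _ _).symm]

end Frame

/-! ### Gain guaranteed by the alternating algorithm -/

section AlgorithmAnalysis

variable {n1 n2 n3 r1 r2 s1 s2 : ℕ} {X : Tensor n1 n2 n3}

/-- The initial `U1` is a projector matrix and not a Stiefel matrix, but its `proj` is itself. The
initialization thus corresponds to the admissible choice `u = 1 - P`. -/
theorem OrthTT.leftOp_perp (D : OrthTT X r1 r2) :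
    (leftOp (TTCone.proj (perp D.X1p)) : Module.End ℝ (Tensor n1 n2 n3)) = 1 - D.P := by
  rw [D.orth_X1p.proj_perp, perp_eq, leftOp_one_sub, OrthTT.P]

theorem OrthTT.rightOp_perp (D : OrthTT X r1 r2) :
    (rightOp (TTCone.proj (perp D.X3ppᵀ)ᵀ) : Module.End ℝ (Tensor n1 n2 n3)) = 1 - D.Q := by
  rw [transpose_perp, D.orth_X3pp.proj_perp, perp_eq, rightOp_one_sub, OrthTT.Q]

/-- The parameters `U1` and `V3` that may occur in the tensor computed by the algorithm. -/
structure OrthTT.IsParam (D : OrthTT X r1 r2) (U1 : Matrix (Fin n1) (Fin s1) ℝ)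
    (V3 : Matrix (Fin s2) (Fin n3) ℝ) : Prop where
  orthU : IsStiefel U1
  mulU : U1ᵀ * D.X1p = 0
  orthV : IsStiefel V3ᵀ
  mulV : V3 * D.X3ppᵀ = 0

theorem OrthTT.IsParam.admU {D : OrthTT X r1 r2} {U1 : Matrix (Fin n1) (Fin s1) ℝ}
    {V3 : Matrix (Fin s2) (Fin n3) ℝ} (h : D.IsParam U1 V3) :
    IsAdmissible D.P D.Q D.R (leftOp (TTCone.proj U1)) :=
  D.isAdmissible_leftOp h.orthU h.mulU

theorem OrthTT.IsParam.admV {D : OrthTT X r1 r2} {U1 : Matrix (Fin n1) (Fin s1) ℝ}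
    {V3 : Matrix (Fin s2) (Fin n3) ℝ} (h : D.IsParam U1 V3) :
    IsAdmissible D.Q D.P D.K (rightOp (TTCone.proj V3ᵀ)) :=
  D.isAdmissible_rightOp h.orthV h.mulV

/-- The part of the squared norm of the computed tensor that depends on `U1` and `V3`. -/
def OrthTT.gain (D : OrthTT X r1 r2) (Y : Tensor n1 n2 n3) (U1 : Matrix (Fin n1) (Fin s1) ℝ)
    (V3 : Matrix (Fin s2) (Fin n3) ℝ) : ℝ :=
  TTCone.gain D.P D.Q D.R D.K (leftOp (TTCone.proj U1)) (rightOp (TTCone.proj V3ᵀ)) Y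

theorem SelectU.isStiefel {q : ℕ} {D : OrthTT X r1 r2} {Y : Tensor n1 n2 n3}
    {V3 : Matrix (Fin q) (Fin n3) ℝ} {U1 : Matrix (Fin n1) (Fin s1) ℝ}
    {S : Matrix (Fin s1) (Fin s1) ℝ} (h : SelectU D Y V3 U1 S) : IsStiefel U1 := by
  obtain ⟨⟨V, hV⟩, -⟩ := h
  exact hV.isStiefel_left

theorem SelectV.isStiefel {p : ℕ} {D : OrthTT X r1 r2} {Y : Tensor n1 n2 n3}
    {U1 : Matrix (Fin n1) (Fin p) ℝ} {V3 : Matrix (Fin s2) (Fin n3) ℝ}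
    {S : Matrix (Fin s2) (Fin s2) ℝ} (h : SelectV D Y U1 V3 S) : IsStiefel V3ᵀ := by
  obtain ⟨⟨U, hU⟩, -⟩ := h
  exact hU.transpose.isStiefel_left

theorem SelectU.leftGain_le {q : ℕ} {D : OrthTT X r1 r2} {Y : Tensor n1 n2 n3}
    {V3 : Matrix (Fin q) (Fin n3) ℝ} {U1 : Matrix (Fin n1) (Fin s1) ℝ}
    {S : Matrix (Fin s1) (Fin s1) ℝ} (h : SelectU D Y V3 U1 S)
    (hV : IsAdmissible D.Q D.P D.K (rightOp (proj V3ᵀ)))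
    {W : Matrix (Fin n1) (Fin s1) ℝ} (hW : IsStiefel W) (hWX : Wᵀ * D.X1p = 0) :
    leftGain D.Q D.R (leftOp (proj W)) (rightOp (proj V3ᵀ)) Y
      ≤ leftGain D.Q D.R (leftOp (proj U1)) (rightOp (proj V3ᵀ)) Y := by
  rw [← D.frobSq_proj_mul_leftMat Y hV (D.isAdmissible_leftOp hW hWX),
    ← D.frobSq_proj_mul_leftMat Y hV (D.isAdmissible_leftOp h.isStiefel h.2)]
  obtain ⟨⟨V, hsvd⟩, -⟩ := h
  exact hsvd.frobSq_proj_mul_le hW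

theorem SelectV.leftGain_le {p : ℕ} {D : OrthTT X r1 r2} {Y : Tensor n1 n2 n3}
    {U1 : Matrix (Fin n1) (Fin p) ℝ} {V3 : Matrix (Fin s2) (Fin n3) ℝ}
    {S : Matrix (Fin s2) (Fin s2) ℝ} (h : SelectV D Y U1 V3 S)
    (hU : IsAdmissible D.P D.Q D.R (leftOp (proj U1)))
    {W : Matrix (Fin s2) (Fin n3) ℝ} (hW : IsStiefel Wᵀ) (hWX : W * D.X3ppᵀ = 0) :
    leftGain D.P D.K (rightOp (proj Wᵀ)) (leftOp (proj U1)) Y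
      ≤ leftGain D.P D.K (rightOp (proj V3ᵀ)) (leftOp (proj U1)) Y := by
  rw [← D.frobSq_rightMat_mul_proj Y hU (D.isAdmissible_rightOp hW hWX),
    ← D.frobSq_rightMat_mul_proj Y hU (D.isAdmissible_rightOp h.isStiefel h.2)]
  obtain ⟨⟨U, hsvd⟩, -⟩ := h
  have := hsvd.transpose.frobSq_proj_mul_le hW
  rwa [← transpose_proj Wᵀ, ← transpose_proj V3ᵀ, ← Matrix.transpose_mul, ← Matrix.transpose_mul,
    frobSq_transpose, frobSq_transpose] at this

theorem OrthTT.exists_complement_X1p (D : OrthTT X r1 r2) :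
    ∃ E : Matrix (Fin n1) (Fin (n1 - r1)) ℝ, IsStiefel E ∧ Eᵀ * D.X1p = 0 ∧
      E * Eᵀ = perp D.X1p := by
  obtain ⟨E, hE, hE0, hE1⟩ := D.orth_X1p.exists_complement
  refine ⟨E, hE, ?_, eq_sub_of_add_eq' hE1⟩
  rw [← Matrix.transpose_transpose D.X1p, ← Matrix.transpose_mul, hE0, Matrix.transpose_zero]

theorem OrthTT.exists_complement_X3pp (D : OrthTT X r1 r2) :
    ∃ E : Matrix (Fin n3) (Fin (n3 - r2)) ℝ, IsStiefel E ∧ Eᵀ * D.X3ppᵀ = 0 ∧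
      E * Eᵀ = perp D.X3ppᵀ := by
  obtain ⟨E, hE, hE0, hE1⟩ := D.orth_X3pp.exists_complement
  refine ⟨E, hE, ?_, eq_sub_of_add_eq' hE1⟩
  rw [← Matrix.transpose_transpose (Eᵀ * D.X3ppᵀ), Matrix.transpose_mul,
    Matrix.transpose_transpose E, hE0, Matrix.transpose_zero]

theorem OrthTT.perp_mul_leftMat {q : ℕ} (D : OrthTT X r1 r2) (Y : Tensor n1 n2 n3)
    (V3 : Matrix (Fin q) (Fin n3) ℝ) : perp D.X1p * leftMat D Y V3 = leftMat D Y V3 := by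
  have h : perp D.X1p * perp D.X1p = perp D.X1p := by
    conv_rhs => rw [← D.orth_X1p.proj_perp, proj, transpose_perp]
  rw [leftMat, ← Matrix.mul_assoc, h]

theorem OrthTT.rightMat_mul_perp {p : ℕ} (D : OrthTT X r1 r2) (Y : Tensor n1 n2 n3)
    (U1 : Matrix (Fin n1) (Fin p) ℝ) : rightMat D Y U1 * perp D.X3ppᵀ = rightMat D Y U1 := by
  have h : perp D.X3ppᵀ * perp D.X3ppᵀ = perp D.X3ppᵀ := by
    conv_rhs => rw [← D.orth_X3pp.proj_perp, proj, transpose_perp]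
  rw [rightMat, Matrix.mul_assoc, h]

/-- The columns of the decomposed matrix are orthogonal to `X1p`, so they lie in a space of
dimension `n1 - r1`. -/
theorem SelectU.mul_leftGain_le {q : ℕ} {D : OrthTT X r1 r2} {Y : Tensor n1 n2 n3}
    {V3 : Matrix (Fin q) (Fin n3) ℝ} {U1 : Matrix (Fin n1) (Fin s1) ℝ}
    {S : Matrix (Fin s1) (Fin s1) ℝ} (h : SelectU D Y V3 U1 S) (hs : s1 ≤ n1 - r1)
    (hV : IsAdmissible D.Q D.P D.K (rightOp (proj V3ᵀ))) :
    s1 * leftGain D.Q D.R (1 - D.P) (rightOp (proj V3ᵀ)) Y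
      ≤ (n1 - r1 : ℕ) * leftGain D.Q D.R (leftOp (proj U1)) (rightOp (proj V3ᵀ)) Y := by
  rw [← D.leftOp_perp, ← D.frobSq_proj_mul_leftMat Y hV (D.leftOp_perp ▸ D.isFrame.one_sub_admissible),
    ← D.frobSq_proj_mul_leftMat Y hV (D.isAdmissible_leftOp h.isStiefel h.2),
    D.orth_X1p.proj_perp, D.perp_mul_leftMat]
  obtain ⟨⟨V, hsvd⟩, -⟩ := h
  obtain ⟨E, hE, -, hE1⟩ := D.exists_complement_X1p
  exact hsvd.mul_frobSq_le hE (by rw [hE1, D.perp_mul_leftMat]) hs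

theorem SelectV.mul_leftGain_le {p : ℕ} {D : OrthTT X r1 r2} {Y : Tensor n1 n2 n3}
    {U1 : Matrix (Fin n1) (Fin p) ℝ} {V3 : Matrix (Fin s2) (Fin n3) ℝ}
    {S : Matrix (Fin s2) (Fin s2) ℝ} (h : SelectV D Y U1 V3 S) (hs : s2 ≤ n3 - r2)
    (hU : IsAdmissible D.P D.Q D.R (leftOp (proj U1))) :
    s2 * leftGain D.P D.K (1 - D.Q) (leftOp (proj U1)) Y
      ≤ (n3 - r2 : ℕ) * leftGain D.P D.K (rightOp (proj V3ᵀ)) (leftOp (proj U1)) Y := by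
  rw [← D.rightOp_perp,
    ← D.frobSq_rightMat_mul_proj Y hU (D.rightOp_perp ▸ D.isFrame.swap.one_sub_admissible),
    ← D.frobSq_rightMat_mul_proj Y hU (D.isAdmissible_rightOp h.isStiefel h.2),
    transpose_perp, D.orth_X3pp.proj_perp, D.rightMat_mul_perp]
  obtain ⟨⟨U, hsvd⟩, -⟩ := h
  obtain ⟨E, hE, -, hE1⟩ := D.exists_complement_X3pp
  have := hsvd.transpose.mul_frobSq_le hE (by
    rw [hE1, ← transpose_perp, ← Matrix.transpose_mul, D.rightMat_mul_perp]) hs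
  rwa [← transpose_proj V3ᵀ, ← Matrix.transpose_mul, frobSq_transpose, frobSq_transpose] at this

/-- The remaining term of the gain does not involve `U1`, so an SVD step is an exact maximization in
one variable. -/
theorem SelectU.gain_le {D : OrthTT X r1 r2} {Y : Tensor n1 n2 n3}
    {V3 : Matrix (Fin s2) (Fin n3) ℝ} {U1 W : Matrix (Fin n1) (Fin s1) ℝ}
    {S : Matrix (Fin s1) (Fin s1) ℝ} (h : SelectU D Y V3 U1 S) (hp : D.IsParam W V3) :
    D.gain Y W V3 ≤ D.gain Y U1 V3 := by
  rw [OrthTT.gain, OrthTT.gain, gain_eq_leftGain_add, gain_eq_leftGain_add]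
  exact add_le_add_left (h.leftGain_le hp.admV hp.orthU hp.mulU) _

theorem SelectV.gain_le {D : OrthTT X r1 r2} {Y : Tensor n1 n2 n3}
    {V3 W : Matrix (Fin s2) (Fin n3) ℝ} {U1 : Matrix (Fin n1) (Fin s1) ℝ}
    {S : Matrix (Fin s2) (Fin s2) ℝ} (h : SelectV D Y U1 V3 S) (hp : D.IsParam U1 W) :
    D.gain Y U1 W ≤ D.gain Y U1 V3 := by
  rw [OrthTT.gain, OrthTT.gain, ← gain_swap (commute_leftOp_rightOp _ _),
    ← gain_swap (commute_leftOp_rightOp _ _), gain_eq_leftGain_add, gain_eq_leftGain_add]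
  exact add_le_add_left (h.leftGain_le hp.admU hp.orthV hp.mulV) _

theorem leftGain_nonneg {E : Type*} [NormedAddCommGroup E] [InnerProductSpace ℝ E]
    (Q R u v : Module.End ℝ E) (y : E) : 0 ≤ leftGain Q R u v y := by
  unfold leftGain
  positivity

/-- Covers the convention for `0/0`: when `d = 0` the claim is `0 ≤ b`. -/
theorem div_mul_le_of_mul_le {s d a b : ℝ} (hd : 0 ≤ d) (hb : 0 ≤ b) (h : s * a ≤ d * b) :
    s / d * a ≤ b := by
  rcases hd.eq_or_lt with rfl | hd
  · simpa using hb
  · rw [div_mul_eq_mul_div, div_le_iff₀ hd, mul_comm b]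
    exact h

theorem div_sub_le_one {s n r : ℕ} (h : s ≤ n - r) (hr : r ≤ n) : (s : ℝ) / ((n : ℝ) - r) ≤ 1 := by
  rw [← Nat.cast_sub hr]
  exact div_le_one_of_le₀ (by exact_mod_cast h) (Nat.cast_nonneg _)

theorem div_sub_nonneg {s n r : ℕ} (hr : r ≤ n) : 0 ≤ (s : ℝ) / ((n : ℝ) - r) :=
  div_nonneg (Nat.cast_nonneg _) (sub_nonneg.2 (Nat.cast_le.2 hr))

/-- The smallest possible ratio of the gain to the maximal gain after one pass of the loop. -/
def ratio (n1 n3 r1 r2 s1 s2 : ℕ) : ℝ :=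
  max ((s1 : ℝ) / ((n1 : ℝ) - r1)) ((s2 : ℝ) / ((n3 : ℝ) - r2))

/-- The first pass: `U1` is optimal against the full complement of `Q`, and `V3` keeps the fraction
`s2 / (n3 - r2)`. -/
theorem gain_of_selectU_selectV {D : OrthTT X r1 r2} {Y : Tensor n1 n2 n3}
    {U1 : Matrix (Fin n1) (Fin s1) ℝ} {S1 : Matrix (Fin s1) (Fin s1) ℝ}
    {V3 : Matrix (Fin s2) (Fin n3) ℝ} {S2 : Matrix (Fin s2) (Fin s2) ℝ}
    (hs2 : s2 ≤ n3 - r2) (hr2 : r2 ≤ n3)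
    (h1 : SelectU D Y (perp D.X3ppᵀ) U1 S1) (h2 : SelectV D Y U1 V3 S2)
    {U : Matrix (Fin n1) (Fin s1) ℝ} {V : Matrix (Fin s2) (Fin n3) ℝ} (hp : D.IsParam U V) :
    (s2 : ℝ) / ((n3 : ℝ) - r2) * D.gain Y U V ≤ D.gain Y U1 V3 := by
  have hadm := D.isAdmissible_leftOp h1.isStiefel h1.2
  refine mul_gain_le_of_choice D.isFrame hp.admV (commute_leftOp_rightOp _ _)
    (commute_leftOp_rightOp _ _) hadm (div_sub_nonneg hr2) (div_sub_le_one hs2 hr2) ?_ ?_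
  · rw [← D.rightOp_perp]
    exact h1.leftGain_le (D.rightOp_perp ▸ D.isFrame.swap.one_sub_admissible) hp.orthU hp.mulU
  · refine div_mul_le_of_mul_le (sub_nonneg.2 (Nat.cast_le.2 hr2)) (leftGain_nonneg _ _ _ _ _) ?_
    rw [← Nat.cast_sub hr2]
    exact h2.mul_leftGain_le hs2 hadm

theorem gain_of_selectV_selectU {D : OrthTT X r1 r2} {Y : Tensor n1 n2 n3}
    {U1 : Matrix (Fin n1) (Fin s1) ℝ} {S1 : Matrix (Fin s1) (Fin s1) ℝ}
    {V3 : Matrix (Fin s2) (Fin n3) ℝ} {S2 : Matrix (Fin s2) (Fin s2) ℝ}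
    (hs1 : s1 ≤ n1 - r1) (hr1 : r1 ≤ n1)
    (h2 : SelectV D Y (perp D.X1p) V3 S2) (h1 : SelectU D Y V3 U1 S1)
    {U : Matrix (Fin n1) (Fin s1) ℝ} {V : Matrix (Fin s2) (Fin n3) ℝ} (hp : D.IsParam U V) :
    (s1 : ℝ) / ((n1 : ℝ) - r1) * D.gain Y U V ≤ D.gain Y U1 V3 := by
  have hadm := D.isAdmissible_rightOp h2.isStiefel h2.2
  rw [OrthTT.gain, OrthTT.gain, ← gain_swap (commute_leftOp_rightOp _ _),
    ← gain_swap (commute_leftOp_rightOp (proj U1) _)]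
  refine mul_gain_le_of_choice D.isFrame.swap hp.admU (commute_leftOp_rightOp _ _).symm
    (commute_leftOp_rightOp _ _).symm hadm (div_sub_nonneg hr1) (div_sub_le_one hs1 hr1) ?_ ?_
  · rw [← D.leftOp_perp]
    exact h2.leftGain_le (D.leftOp_perp ▸ D.isFrame.one_sub_admissible) hp.orthV hp.mulV
  · refine div_mul_le_of_mul_le (sub_nonneg.2 (Nat.cast_le.2 hr1)) (leftGain_nonneg _ _ _ _ _) ?_
    rw [← Nat.cast_sub hr1]
    exact h1.mul_leftGain_le hs1 hadm

/-- Parameters whose gain is at least the fraction `c` of the maximal gain. -/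
structure OrthTT.IsGood (D : OrthTT X r1 r2) (Y : Tensor n1 n2 n3) (c : ℝ)
    (U1 : Matrix (Fin n1) (Fin s1) ℝ) (V3 : Matrix (Fin s2) (Fin n3) ℝ) : Prop
    extends D.IsParam U1 V3 where
  mul_gain_le : ∀ (U : Matrix (Fin n1) (Fin s1) ℝ) (V : Matrix (Fin s2) (Fin n3) ℝ),
    D.IsParam U V → c * D.gain Y U V ≤ D.gain Y U1 V3

/-- Initially the difference of the two values is `∞`, so at least one pass takes place whatever `ε`
is. -/
theorem algGuard_algInit (D : OrthTT X r1 r2) {ε : ℝ} {imax : ℕ} (himax : 0 < imax) :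
    algGuard ε imax (algInit D) :=
  ⟨himax, by simp [algInit]⟩

/-- After at least one pass of the loop the parameters are good. -/
theorem good_of_reflTransGen {D : OrthTT X r1 r2} {Y : Tensor n1 n2 n3} {ε : ℝ} {imax : ℕ}
    (hs1 : s1 ≤ n1 - r1) (hr1 : r1 ≤ n1) (hs2 : s2 ≤ n3 - r2) (hr2 : r2 ≤ n3)
    {st : AlgState n1 n3}
    (h : Relation.ReflTransGen (algStep s1 s2 ε imax D Y) (algInit D) st) :
    st = algInit D ∨ ∃ (U1 : Matrix (Fin n1) (Fin s1) ℝ) (V3 : Matrix (Fin s2) (Fin n3) ℝ) (i : ℕ)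
      (e e' : EReal), st = ⟨s1, s2, U1, V3, i, e, e'⟩ ∧
        D.IsGood Y (ratio n1 n3 r1 r2 s1 s2) U1 V3 := by
  induction h with
  | refl => exact Or.inl rfl
  | tail _ hstep ih =>
    right
    obtain ⟨-, ⟨hlt, U1, S1, V3, S, hU, hV, rfl⟩ | ⟨hlt, V3, S2, U1, S, hV, hU, rfl⟩⟩ := hstep
    all_goals
      have hp : D.IsParam U1 V3 := ⟨hU.isStiefel, hU.2, hV.isStiefel, hV.2⟩
      refine ⟨U1, V3, _, _, _, rfl, hp, fun U V hUV => ?_⟩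
      -- A first pass starts from the complements and earns the ratio; in a later pass each of the
      -- two SVDs can only raise the gain of the previous pair.
      rcases ih with rfl | ⟨U', V', i, e, e', rfl, hg⟩
    · rw [ratio, max_eq_right hlt.le]
      exact gain_of_selectU_selectV hs2 hr2 hU hV hUV
    · refine (hg.mul_gain_le U V hUV).trans ((hU.gain_le hg.toIsParam).trans (hV.gain_le ?_))
      exact ⟨hU.isStiefel, hU.2, hg.orthV, hg.mulV⟩
    · rw [ratio, max_eq_left (not_lt.1 hlt)]
      exact gain_of_selectV_selectU hs1 hr1 hV hU hUV
    · refine (hg.mul_gain_le U V hUV).trans ((hV.gain_le hg.toIsParam).trans (hU.gain_le ?_))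
      exact ⟨hg.orthU, hg.mulU, hV.isStiefel, hV.2⟩

theorem IsAlgOutput.isGood {D : OrthTT X r1 r2} {Y : Tensor n1 n2 n3} {ε : ℝ} {imax : ℕ}
    (himax : 0 < imax)
    (hs1 : s1 ≤ n1 - r1) (hr1 : r1 ≤ n1) (hs2 : s2 ≤ n3 - r2) (hr2 : r2 ≤ n3)
    {U1 : Matrix (Fin n1) (Fin s1) ℝ} {V3 : Matrix (Fin s2) (Fin n3) ℝ}
    (h : IsAlgOutput ε imax D Y U1 V3) : D.IsGood Y (ratio n1 n3 r1 r2 s1 s2) U1 V3 := by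
  obtain ⟨i, e, e', hreach, hguard⟩ := h
  rcases good_of_reflTransGen hs1 hr1 hs2 hr2 hreach with h | ⟨U, V, j, f, f', h, hg⟩
  -- The initial state is no output, even when the matrix sizes happen to coincide: the loop
  -- condition holds there.
  · exact absurd (h ▸ algGuard_algInit D himax) hguard
  · simp only [AlgState.mk.injEq, heq_eq_eq, true_and] at h
    obtain ⟨rfl, rfl, -⟩ := h
    exact hg

/-! ## Existence of an output -/

/-- The left singular vectors are taken inside the complement of `X1p`, which secures the
orthogonality constraint also for matrices of small rank. -/
theorem exists_selectU {q : ℕ} (D : OrthTT X r1 r2) (Y : Tensor n1 n2 n3)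
    (V3 : Matrix (Fin q) (Fin n3) ℝ) (hs : s1 ≤ n1 - r1) (hs' : s1 ≤ n2 * n3) :
    ∃ (U1 : Matrix (Fin n1) (Fin s1) ℝ) (S : _), SelectU D Y V3 U1 S := by
  obtain ⟨E, hE, hE0, hE1⟩ := D.exists_complement_X1p
  obtain ⟨F, S, V, h⟩ := exists_isTruncSVD_of_proj_mul_eq (leftMat D Y V3) hE
    (by rw [hE1, D.perp_mul_leftMat]) hs (by simpa using hs')
  exact ⟨E * F, S, ⟨V, h⟩, by rw [Matrix.transpose_mul, Matrix.mul_assoc, hE0, Matrix.mul_zero]⟩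

theorem exists_selectV {p : ℕ} (D : OrthTT X r1 r2) (Y : Tensor n1 n2 n3)
    (U1 : Matrix (Fin n1) (Fin p) ℝ) (hs : s2 ≤ n3 - r2) (hs' : s2 ≤ n1 * n2) :
    ∃ (V3 : Matrix (Fin s2) (Fin n3) ℝ) (S : _), SelectV D Y U1 V3 S := by
  obtain ⟨E, hE, hE0, hE1⟩ := D.exists_complement_X3pp
  obtain ⟨F, S, V, h⟩ := exists_isTruncSVD_of_proj_mul_eq (rightMat D Y U1)ᵀ hE
    (by rw [hE1, ← transpose_perp, ← Matrix.transpose_mul, D.rightMat_mul_perp]) hs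
    (by simpa using hs')
  exact ⟨(E * F)ᵀ, S, ⟨V, by simpa using h.transpose⟩,
    by rw [Matrix.transpose_mul, Matrix.mul_assoc, hE0, Matrix.mul_zero]⟩

theorem exists_algStep (D : OrthTT X r1 r2) (Y : Tensor n1 n2 n3) {ε : ℝ} {imax : ℕ}
    (hs1 : s1 ≤ n1 - r1) (hs1' : s1 ≤ n2 * n3) (hs2 : s2 ≤ n3 - r2) (hs2' : s2 ≤ n1 * n2)
    {st : AlgState n1 n3} (h : algGuard ε imax st) :
    ∃ (U1 : Matrix (Fin n1) (Fin s1) ℝ) (V3 : Matrix (Fin s2) (Fin n3) ℝ) (e e' : EReal),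
      algStep s1 s2 ε imax D Y st ⟨s1, s2, U1, V3, st.i + 1, e, e'⟩ := by
  by_cases hlt : (s1 : ℝ) / ((n1 : ℝ) - r1) < (s2 : ℝ) / ((n3 : ℝ) - r2)
  · obtain ⟨U1, S1, hU⟩ := exists_selectU D Y st.V3 hs1 hs1'
    obtain ⟨V3, S, hV⟩ := exists_selectV D Y U1 hs2 hs2'
    exact ⟨U1, V3, _, _, h, Or.inl ⟨hlt, U1, S1, V3, S, hU, hV, rfl⟩⟩
  · obtain ⟨V3, S2, hV⟩ := exists_selectV D Y st.U1 hs2 hs2'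
    obtain ⟨U1, S, hU⟩ := exists_selectU D Y V3 hs1 hs1'
    exact ⟨U1, V3, _, _, h, Or.inr ⟨hlt, V3, S2, U1, S, hV, hU, rfl⟩⟩

theorem exists_isAlgOutput (D : OrthTT X r1 r2) (Y : Tensor n1 n2 n3) {ε : ℝ} {imax : ℕ}
    (himax : 0 < imax)
    (hs1 : s1 ≤ n1 - r1) (hs1' : s1 ≤ n2 * n3) (hs2 : s2 ≤ n3 - r2) (hs2' : s2 ≤ n1 * n2) :
    ∃ (U1 : Matrix (Fin n1) (Fin s1) ℝ) (V3 : Matrix (Fin s2) (Fin n3) ℝ),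
      IsAlgOutput ε imax D Y U1 V3 := by
  -- Termination: induction on the number `imax - i` of passes still allowed.
  have key : ∀ (m : ℕ) (st : AlgState n1 n3), imax - st.i = m → algGuard ε imax st →
      Relation.ReflTransGen (algStep s1 s2 ε imax D Y) (algInit D) st →
      ∃ (U1 : Matrix (Fin n1) (Fin s1) ℝ) (V3 : Matrix (Fin s2) (Fin n3) ℝ),
        IsAlgOutput ε imax D Y U1 V3 := by
    intro m
    induction m with
    | zero => intro st hm hg _; have := hg.1; omega
    | succ m ih =>
      intro st hm hg hreach
      obtain ⟨U1, V3, e, e', hstep⟩ := exists_algStep D Y hs1 hs1' hs2 hs2' hg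
      have hreach' := hreach.tail hstep
      by_cases hg' : algGuard ε imax (⟨s1, s2, U1, V3, st.i + 1, e, e'⟩ : AlgState n1 n3)
      · exact ih _ (by change imax - (st.i + 1) = m; omega) hg' hreach'
      · exact ⟨U1, V3, _, _, _, hreach', hg'⟩
  exact key _ (algInit D) rfl (algGuard_algInit D himax) .refl

end AlgorithmAnalysis

/-! ## The variety of tensors of bounded TT-rank -/

section Variety

open Filter Topology

variable {n1 n2 n3 r1 r2 k1 k2 : ℕ} {X : Tensor n1 n2 n3}

theorem hasTTD_self (X : Tensor n1 n2 n3) : HasTTD X n1 n3 :=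
  ⟨1, X, 1, by rw [rmul_one, lmul_one]⟩

theorem exists_isStiefel_lmul_eq {q1 q2 k : ℕ} (h : HasTTD X q1 q2) (hq : q1 ≤ k) (hk : k ≤ n1) :
    ∃ A : Matrix (Fin n1) (Fin k) ℝ, IsStiefel A ∧ lmul (proj A) X = X := by
  obtain ⟨X1, X2, X3, rfl⟩ := h
  obtain ⟨A, hA, hAX⟩ := exists_isStiefel_proj_mul_eq X1 hq hk
  exact ⟨A, hA, by rw [lmul_lmul, proj, hAX]⟩

theorem exists_isStiefel_rmul_eq {q1 q2 k : ℕ} (h : HasTTD X q1 q2) (hq : q2 ≤ k) (hk : k ≤ n3) :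
    ∃ A : Matrix (Fin n3) (Fin k) ℝ, IsStiefel A ∧ rmul X (proj A) = X := by
  obtain ⟨X1, X2, X3, rfl⟩ := h
  obtain ⟨A, hA, hAX⟩ := exists_isStiefel_proj_mul_eq X3ᵀ hq hk
  refine ⟨A, hA, ?_⟩
  rw [rmul_lmul, rmul_rmul, ← transpose_proj, ← Matrix.transpose_transpose X3,
    ← Matrix.transpose_mul, proj, hAX]

/-- The two entries of the TT-rank can be minimized simultaneously. -/
theorem exists_isTTRank (X : Tensor n1 n2 n3) : ∃ q1 q2, IsTTRank X q1 q2 := by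
  classical
  have h1 : ∃ q1 q2, HasTTD X q1 q2 := ⟨n1, n3, hasTTD_self X⟩
  have h2 : ∃ q2 q1, HasTTD X q1 q2 := ⟨n3, n1, hasTTD_self X⟩
  obtain ⟨a, ha⟩ := Nat.find_spec h1
  obtain ⟨b, hb⟩ := Nat.find_spec h2
  refine ⟨Nat.find h1, Nat.find h2, ?_, fun q1 q2 h =>
    ⟨Nat.find_min' h1 ⟨q2, h⟩, Nat.find_min' h2 ⟨q1, h⟩⟩⟩
  -- The two minima may come from different decompositions. Left and right projectors commute, so
  -- both can be applied to `X` at once, giving a decomposition minimal in both entries.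
  obtain ⟨A, -, hA⟩ := exists_isStiefel_lmul_eq ha le_rfl (Nat.find_min' h1 ⟨n3, hasTTD_self X⟩)
  obtain ⟨B, -, hB⟩ := exists_isStiefel_rmul_eq hb le_rfl (Nat.find_min' h2 ⟨n1, hasTTD_self X⟩)
  refine ⟨A, lmul Aᵀ (rmul X B), Bᵀ, ?_⟩
  rw [rmul_lmul, lmul_lmul, rmul_rmul]
  change X = lmul (proj A) (rmul X (proj B))
  rw [hB, hA]

theorem mem_boundedTT {q1 q2 : ℕ} (h : HasTTD X q1 q2) (h1 : q1 ≤ k1) (h2 : q2 ≤ k2) :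
    X ∈ boundedTT n1 n2 n3 k1 k2 := by
  obtain ⟨a, b, hab⟩ := exists_isTTRank X
  obtain ⟨ha, hb⟩ := hab.2 _ _ h
  exact ⟨a, b, hab, ha.trans h1, hb.trans h2⟩

/-! ## The middle core of `X` -/

theorem OrthTT.X_eq_lmul (D : OrthTT X r1 r2) : X = lmul D.X1 D.rowTensor := D.eq_pp

theorem OrthTT.X_eq_rmul (D : OrthTT X r1 r2) : X = rmul D.colTensor D.X3 := by
  rw [OrthTT.colTensor, rmul_lmul]
  exact D.eq_p

theorem OrthTT.lUnf_mul_row (D : OrthTT X r1 r2) : lUnf X * (lUnf D.rowTensor)ᵀ = D.X1 := by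
  refine (congrArg (fun T => lUnf T * (lUnf D.rowTensor)ᵀ) D.X_eq_lmul).trans ?_
  have := D.isStiefel_rowTensor
  rw [IsStiefel, Matrix.transpose_transpose] at this
  rw [lUnf_lmul, Matrix.mul_assoc, this, Matrix.mul_one]

theorem OrthTT.col_mul_rUnf (D : OrthTT X r1 r2) : (rUnf D.colTensor)ᵀ * rUnf X = D.X3 := by
  refine (congrArg (fun T => (rUnf D.colTensor)ᵀ * rUnf T) D.X_eq_rmul).trans ?_
  have : (rUnf D.colTensor)ᵀ * rUnf D.colTensor = 1 := D.isStiefel_colTensor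
  rw [rUnf_rmul, ← Matrix.mul_assoc, this, Matrix.one_mul]

theorem OrthTT.lmul_proj_X (D : OrthTT X r1 r2) : lmul (TTCone.proj D.X1p) X = X := by
  refine (congrArg (lmul (TTCone.proj D.X1p)) D.eq_p).trans ?_
  rw [lmul_lmul, D.orth_X1p.proj_mul_self]
  exact D.eq_p.symm

theorem OrthTT.rmul_proj_X (D : OrthTT X r1 r2) : rmul X (TTCone.proj D.X3ppᵀ) = X := by
  refine (congrArg (fun T => rmul T (TTCone.proj D.X3ppᵀ)) D.eq_pp).trans ?_
  rw [rmul_lmul, rmul_rmul, TTCone.proj, Matrix.transpose_transpose, ← Matrix.mul_assoc,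
    D.X3pp_mul, Matrix.one_mul]
  exact D.eq_pp.symm

theorem OrthTT.X1_eq (D : OrthTT X r1 r2) : D.X1p * (D.X1pᵀ * D.X1) = D.X1 := by
  have h := congrArg (fun T => lUnf T * (lUnf D.rowTensor)ᵀ) D.lmul_proj_X
  simpa only [lUnf_lmul, TTCone.proj, Matrix.mul_assoc, D.lUnf_mul_row] using h

theorem OrthTT.X3_eq (D : OrthTT X r1 r2) : D.X3 * D.X3ppᵀ * D.X3pp = D.X3 := by
  have h := congrArg (fun T => (rUnf D.colTensor)ᵀ * rUnf T) D.rmul_proj_X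
  simpa only [rUnf_rmul, TTCone.proj, ← Matrix.mul_assoc, D.col_mul_rUnf,
    Matrix.transpose_transpose] using h

/-- Were this matrix singular, it would factor through a smaller dimension and lower the first entry
of the TT-rank. -/
theorem OrthTT.isUnit_left (D : OrthTT X r1 r2) (hX : IsTTRank X r1 r2) :
    IsUnit (D.X1pᵀ * D.X1) := by
  by_contra h
  obtain ⟨q, hq, E, F, hEF⟩ := exists_mul_eq_of_not_isUnit _ h
  refine absurd (hX.2 q r2 ⟨D.X1p * E, lmul F D.X2pp, D.X3pp, ?_⟩).1 (not_le.2 hq)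
  rw [rmul_lmul, lmul_lmul, Matrix.mul_assoc, ← hEF, D.X1_eq]
  exact D.eq_pp

theorem OrthTT.isUnit_right (D : OrthTT X r1 r2) (hX : IsTTRank X r1 r2) :
    IsUnit (D.X3 * D.X3ppᵀ) := by
  by_contra h
  obtain ⟨q, hq, E, F, hEF⟩ := exists_mul_eq_of_not_isUnit _ h
  refine absurd (hX.2 r1 q ⟨D.X1p, rmul D.X2p E, F * D.X3pp, ?_⟩).2 (not_le.2 hq)
  rw [rmul_rmul, ← Matrix.mul_assoc, ← hEF, D.X3_eq]
  exact D.eq_p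

/-- `X1'ᵀ · X · X3''ᵀ`. -/
def OrthTT.core (D : OrthTT X r1 r2) : Tensor r1 n2 r2 := lmul D.X1pᵀ (rmul X D.X3ppᵀ)

theorem OrthTT.eq_core (D : OrthTT X r1 r2) : X = lmul D.X1p (rmul D.core D.X3pp) := by
  have h := D.rmul_proj_X
  rw [TTCone.proj, Matrix.transpose_transpose] at h
  rw [OrthTT.core, rmul_lmul, lmul_lmul, rmul_rmul, h]
  exact D.lmul_proj_X.symm

/-- With `core_eq_right`, both orthogonal middle factors differ from one core by invertible
matrices, so `X` can be varied with `X1p` and `X3pp` as outer factors simultaneously. -/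
theorem OrthTT.core_eq_left (D : OrthTT X r1 r2) : D.core = lmul (D.X1pᵀ * D.X1) D.X2pp := by
  refine (congrArg (fun T => lmul D.X1pᵀ (rmul T D.X3ppᵀ)) D.eq_pp).trans ?_
  rw [rmul_lmul, rmul_rmul, D.X3pp_mul, rmul_one, lmul_lmul]

theorem OrthTT.core_eq_right (D : OrthTT X r1 r2) : D.core = rmul D.X2p (D.X3 * D.X3ppᵀ) := by
  refine (congrArg (fun T => lmul D.X1pᵀ (rmul T D.X3ppᵀ)) D.eq_p).trans ?_
  rw [rmul_lmul, lmul_lmul, D.X1p_mul, lmul_one, rmul_rmul]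

/-! ## Tensors in the tangent cone -/

/-- The factors are the block matrices `[A U]`, `[[G, U2], [V2, Z2]]` and `[B; V]`. -/
theorem hasTTD_block {s1 s2 : ℕ} (A : Matrix (Fin n1) (Fin r1) ℝ) (U : Matrix (Fin n1) (Fin s1) ℝ)
    (G : Tensor r1 n2 r2) (U2 : Tensor r1 n2 s2) (V2 : Tensor s1 n2 r2) (Z2 : Tensor s1 n2 s2)
    (B : Matrix (Fin r2) (Fin n3) ℝ) (V : Matrix (Fin s2) (Fin n3) ℝ) :
    HasTTD (lmul A (rmul G B) + lmul A (rmul U2 V) + lmul U (rmul V2 B) + lmul U (rmul Z2 V))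
      (r1 + s1) (r2 + s2) := by
  refine ⟨Matrix.of fun i => Fin.append (A i) (U i),
    WithLp.toLp 2 fun x => Fin.addCases
      (fun a => Fin.append (fun b => G (a, x.2.1, b)) (fun b => U2 (a, x.2.1, b)) x.2.2)
      (fun a => Fin.append (fun b => V2 (a, x.2.1, b)) (fun b => Z2 (a, x.2.1, b)) x.2.2) x.1,
    Matrix.of fun b => Fin.addCases (fun b => B b) (fun b => V b) b, ?_⟩
  ext x
  simp only [lmul, rmul, PiLp.add_apply, Fin.sum_univ_add, Matrix.of_apply, Fin.append_left,
    Fin.append_right, Fin.addCases_left, Fin.addCases_right, mul_add, Finset.sum_add_distrib]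
  ring

/-- The tangent vector is the velocity at `t = 0` of the curve `[A + tα, U] · [[G + tγ, tU2], [tV2,
tZ2]] · [B + tβ; V]`, which equals `X + tZ + t²Z' + t³Z''` and has bounded rank for every `t`. -/
theorem mem_tangentCone_of_block {s1 s2 : ℕ} (A α : Matrix (Fin n1) (Fin r1) ℝ)
    (U : Matrix (Fin n1) (Fin s1) ℝ)
    (G γ : Tensor r1 n2 r2) (U2 : Tensor r1 n2 s2) (V2 : Tensor s1 n2 r2) (Z2 : Tensor s1 n2 s2)
    (B β : Matrix (Fin r2) (Fin n3) ℝ) (V : Matrix (Fin s2) (Fin n3) ℝ)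
    (h1 : r1 + s1 ≤ k1) (h2 : r2 + s2 ≤ k2) :
    lmul α (rmul G B) + lmul A (rmul G β) + lmul A (rmul γ B) + lmul U (rmul V2 B)
      + lmul A (rmul U2 V) + lmul U (rmul Z2 V)
      ∈ tangentCone k1 k2 (lmul A (rmul G B)) := by
  set Z := lmul α (rmul G B) + lmul A (rmul G β) + lmul A (rmul γ B) + lmul U (rmul V2 B)
    + lmul A (rmul U2 V) + lmul U (rmul Z2 V) with hZ
  set Z' := lmul α (rmul γ B) + lmul α (rmul G β) + lmul A (rmul γ β) + lmul α (rmul U2 V)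
    + lmul U (rmul V2 β) with hZ'
  set Z'' := lmul α (rmul γ β) with hZ''
  have hlim : Tendsto (fun t : ℝ => Z + t • Z' + t ^ 2 • Z'') (𝓝[>] 0) (𝓝 Z) := by
    refine tendsto_nhdsWithin_of_tendsto_nhds ?_
    have : Continuous fun t : ℝ => Z + t • Z' + t ^ 2 • Z'' := by fun_prop
    simpa using this.tendsto 0
  refine mem_tangentConeAt_of_seq (𝓝[>] (0 : ℝ)) (fun t => (t⁻¹).toNNReal)
    (fun t => t • (Z + t • Z' + t ^ 2 • Z'')) ?_ ?_ ?_
  · refine tendsto_nhdsWithin_of_tendsto_nhds ?_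
    have : Continuous fun t : ℝ => t • (Z + t • Z' + t ^ 2 • Z'') := by fun_prop
    simpa using this.tendsto 0
  · refine Eventually.of_forall fun t => ?_
    have := hasTTD_block (A + t • α) U (G + t • γ) (t • U2) (t • V2) (t • Z2) (B + t • β) V
    convert mem_boundedTT this h1 h2 using 1
    simp only [hZ, hZ', hZ'', add_lmul, smul_lmul, add_rmul, smul_rmul, rmul_add, rmul_smul,
      lmul_add, lmul_smul]
    module
  · refine hlim.congr' ?_
    filter_upwards [self_mem_nhdsWithin] with t ht
    have ht : (0 : ℝ) < t := ht
    rw [NNReal.smul_def, Real.coe_toNNReal _ (inv_nonneg.2 ht.le), smul_smul,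
      inv_mul_cancel₀ ht.ne', one_smul]

theorem OrthTT.assemble_mem_tangentCone {s1 s2 : ℕ} (D : OrthTT X r1 r2) (hX : IsTTRank X r1 r2)
    (Y : Tensor n1 n2 n3) (U1 : Matrix (Fin n1) (Fin s1) ℝ) (V3 : Matrix (Fin s2) (Fin n3) ℝ)
    (h1 : r1 + s1 ≤ k1) (h2 : r2 + s2 ≤ k2) :
    assemble D Y U1 V3 ∈ tangentCone k1 k2 X := by
  -- The inverse factors compensate for the core replacing `X2pp` on one side and `X2p` on the
  -- other.
  have e1 : lmul (paramW1 D Y * (D.X1pᵀ * D.X1)⁻¹) (rmul D.core D.X3pp)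
      = lmul (paramW1 D Y) (rmul D.X2pp D.X3pp) := by
    rw [D.core_eq_left, rmul_lmul, lmul_lmul, Matrix.mul_assoc, Matrix.nonsing_inv_mul _
      ((Matrix.isUnit_iff_isUnit_det _).1 (D.isUnit_left hX)), Matrix.mul_one]
  have e2 : rmul D.core ((D.X3 * D.X3ppᵀ)⁻¹ * paramW3 D Y) = rmul D.X2p (paramW3 D Y) := by
    rw [D.core_eq_right, rmul_rmul, ← Matrix.mul_assoc, Matrix.mul_nonsing_inv _
      ((Matrix.isUnit_iff_isUnit_det _).1 (D.isUnit_right hX)), Matrix.one_mul]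
  have := mem_tangentCone_of_block D.X1p (paramW1 D Y * (D.X1pᵀ * D.X1)⁻¹) U1 D.core (paramW2 D Y)
    (paramU2 D Y V3) (paramV2 D Y U1) (paramZ2 Y U1 V3) D.X3pp
    ((D.X3 * D.X3ppᵀ)⁻¹ * paramW3 D Y) V3 h1 h2
  rwa [e1, e2, ← D.eq_core] at this

theorem zero_mem_tangentCone (X : Tensor n1 n2 n3) (hX : X ∈ boundedTT n1 n2 n3 k1 k2) :
    (0 : Tensor n1 n2 n3) ∈ tangentCone k1 k2 X :=
  mem_tangentConeAt_of_seq (atTop : Filter ℕ) (fun _ => 0) (fun _ => 0) tendsto_const_nhds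
    (Eventually.of_forall fun _ => by simpa using hX) (by simp)

theorem smul_mem_tangentCone {Z : Tensor n1 n2 n3} (hZ : Z ∈ tangentCone k1 k2 X) {t : ℝ}
    (ht : 0 ≤ t) : t • Z ∈ tangentCone k1 k2 X := by
  obtain ⟨α, l, hl, c, d, hd, hmem, hcd⟩ := exists_fun_of_mem_tangentConeAt hZ
  refine mem_tangentConeAt_of_seq l (fun n => t.toNNReal * c n) d hd hmem ?_
  have := hcd.const_smul t
  refine this.congr fun n => ?_
  rw [mul_smul, NNReal.smul_def t.toNNReal, Real.coe_toNNReal _ ht]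

theorem isClosed_tangentCone : IsClosed (tangentCone k1 k2 X) := by
  rw [tangentCone, tangentConeAt_def]
  exact isClosed_setOfPred_clusterPt

/-! ## Necessary conditions for tangency -/

theorem isCompact_isStiefel {n k : ℕ} : IsCompact {A : Matrix (Fin n) (Fin k) ℝ | IsStiefel A} := by
  have hK : IsCompact (Set.univ.pi fun _ : Fin n => Set.univ.pi fun _ : Fin k => Set.Icc (-1 : ℝ) 1) :=
    isCompact_univ_pi fun _ => isCompact_univ_pi fun _ => isCompact_Icc
  refine IsCompact.of_isClosed_subset (s := (Set.univ.pi fun _ : Fin n =>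
    Set.univ.pi fun _ : Fin k => Set.Icc (-1 : ℝ) 1)) hK ?_ ?_
  · exact isClosed_eq (by fun_prop) continuous_const
  · intro A hA i _ j _
    have h := hA.sum_mul j j
    rw [if_pos rfl] at h
    have h1 : A i j * A i j ≤ 1 := by
      rw [← h]
      exact Finset.single_le_sum (f := fun a => A a j * A a j) (fun _ _ => mul_self_nonneg _)
        (Finset.mem_univ i)
    exact abs_le.1 (abs_le_one_iff_mul_self_le_one.2 h1)

theorem tendsto_lmul {α : Type*} {l : Filter α} {a b c p : ℕ} {M : α → Matrix (Fin p) (Fin a) ℝ}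
    {T : α → Tensor a b c} {M₀ : Matrix (Fin p) (Fin a) ℝ} {T₀ : Tensor a b c}
    (hM : Tendsto M l (𝓝 M₀)) (hT : Tendsto T l (𝓝 T₀)) :
    Tendsto (fun n => lmul (M n) (T n)) l (𝓝 (lmul M₀ T₀)) := by
  have h : Continuous fun x : Matrix (Fin p) (Fin a) ℝ × Tensor a b c => lmul x.1 x.2 := by
    unfold lmul
    fun_prop
  exact (h.tendsto (M₀, T₀)).comp (hM.prodMk_nhds hT)

theorem tendsto_rmul {α : Type*} {l : Filter α} {a b c q : ℕ} {T : α → Tensor a b c}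
    {M : α → Matrix (Fin c) (Fin q) ℝ} {T₀ : Tensor a b c} {M₀ : Matrix (Fin c) (Fin q) ℝ}
    (hT : Tendsto T l (𝓝 T₀)) (hM : Tendsto M l (𝓝 M₀)) :
    Tendsto (fun n => rmul (T n) (M n)) l (𝓝 (rmul T₀ M₀)) := by
  have h : Continuous fun x : Tensor a b c × Matrix (Fin c) (Fin q) ℝ => rmul x.1 x.2 := by
    unfold rmul
    fun_prop
  exact (h.tendsto (T₀, M₀)).comp (hT.prodMk_nhds hM)

/-- A family of orthonormal frames accumulates at an orthonormal frame. -/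
theorem exists_tendsto_proj {α : Type*} {l : Filter α} [l.NeBot] {n k : ℕ}
    {A : α → Matrix (Fin n) (Fin k) ℝ} (hA : ∀ᶠ a in l, IsStiefel (A a)) :
    ∃ (f : Filter α) (A₀ : Matrix (Fin n) (Fin k) ℝ), f.NeBot ∧ f ≤ l ∧ IsStiefel A₀ ∧
      Tendsto (fun a => 1 - proj (A a)) f (𝓝 (1 - proj A₀)) := by
  -- Tangency is witnessed by an arbitrary filter, so an ultrafilter takes the place of a convergent
  -- subsequence.
  have hf : (Ultrafilter.of l : Filter α) ≤ l := Ultrafilter.of_le l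
  obtain ⟨A₀, hA₀, hlim⟩ := isCompact_isStiefel.ultrafilter_le_nhds ((Ultrafilter.of l).map A) (by
    rw [le_principal_iff]
    exact hA.filter_mono hf)
  have h : Continuous fun A : Matrix (Fin n) (Fin k) ℝ => 1 - proj A := by
    unfold proj
    fun_prop
  exact ⟨_, A₀, (Ultrafilter.of l).neBot, hf, hA₀, (h.tendsto A₀).comp hlim⟩

theorem OrthTT.one_sub_R_X (D : OrthTT X r1 r2) : (1 - D.R) X = 0 := by
  rw [LinearMap.sub_apply, D.R_apply, D.lUnf_mul_row, Module.End.one_apply, ← D.X_eq_lmul, sub_self]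

theorem OrthTT.one_sub_K_X (D : OrthTT X r1 r2) : (1 - D.K) X = 0 := by
  rw [LinearMap.sub_apply, D.K_apply, D.col_mul_rUnf, Module.End.one_apply, ← D.X_eq_rmul, sub_self]

/-- Nearby tensors of bounded rank have column spaces inside `k1`-dimensional spaces. A limit of
these spaces contains the columns of `X1p`, and what it adds to them is spanned by `U1`. -/
theorem OrthTT.exists_left_of_mem_tangentCone (D : OrthTT X r1 r2) (hX : IsTTRank X r1 r2)
    (hk1 : k1 ≤ n1) {Z : Tensor n1 n2 n3} (hZ : Z ∈ tangentCone k1 k2 X) :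
    ∃ U1 : Matrix (Fin n1) (Fin (k1 - r1)) ℝ, IsStiefel U1 ∧ U1ᵀ * D.X1p = 0 ∧
      ((1 - D.P - leftOp (TTCone.proj U1) : Module.End ℝ (Tensor n1 n2 n3)) * (1 - D.R)) Z = 0 := by
  obtain ⟨α, l, hl, c, d, hd, hmem, hcd⟩ := exists_fun_of_mem_tangentConeAt hZ
  have hex : ∀ n, ∃ A : Matrix (Fin n1) (Fin k1) ℝ, X + d n ∈ boundedTT n1 n2 n3 k1 k2 →
      IsStiefel A ∧ lmul (TTCone.proj A) (X + d n) = X + d n := by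
    intro n
    by_cases h : X + d n ∈ boundedTT n1 n2 n3 k1 k2
    · obtain ⟨q1, q2, hq, hq1, -⟩ := id h
      obtain ⟨A, hA⟩ := exists_isStiefel_lmul_eq hq.1 hq1 hk1
      exact ⟨A, fun _ => hA⟩
    · exact ⟨0, fun h' => absurd h' h⟩
  choose A hA using hex
  obtain ⟨f, A0, hfne, hf, hA0, hproj⟩ := exists_tendsto_proj (hmem.mono fun n hn => (hA n hn).1)
  have hmem' := hmem.filter_mono hf
  have hzero : ∀ᶠ n in f, lmul (1 - TTCone.proj (A n)) (X + d n) = 0 := by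
    filter_upwards [hmem'] with n hn
    rw [← leftOp_apply, leftOp_one_sub, LinearMap.sub_apply, leftOp_apply, (hA n hn).2]
    exact sub_self _
  have hX0 : lmul (1 - TTCone.proj A0) X = 0 := by
    have h1 : Tendsto (fun n => lmul (1 - TTCone.proj (A n)) (X + d n)) f
        (𝓝 (lmul (1 - TTCone.proj A0) X)) := by
      refine tendsto_lmul hproj ?_
      simpa using tendsto_const_nhds.add (hd.mono_left hf)
    exact tendsto_nhds_unique h1 (tendsto_const_nhds.congr' (hzero.mono fun _ h => h.symm))
  have hZ0 : lmul (1 - TTCone.proj A0) ((1 - D.R) Z) = 0 := by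
    have h1 : Tendsto (fun n => lmul (1 - TTCone.proj (A n)) ((1 - D.R) (c n • d n))) f
        (𝓝 (lmul (1 - TTCone.proj A0) ((1 - D.R) Z))) := by
      refine tendsto_lmul hproj ?_
      exact ((LinearMap.continuous_of_finiteDimensional (1 - D.R)).tendsto Z).comp
        (hcd.mono_left hf)
    refine tendsto_nhds_unique h1 (tendsto_const_nhds.congr' (hzero.mono fun n h => ?_))
    -- As `1 - R` annihilates `X`, the increment may be replaced by `X + d n`, on which `1 - proj (A
    -- n)` vanishes exactly; the size of `c n` is then irrelevant.
    have h2 : (1 - D.R) (d n) = (1 - D.R) (X + d n) := by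
      rw [map_add, D.one_sub_R_X, zero_add]
    have hc : Commute (leftOp (1 - TTCone.proj (A n))) (1 - D.R) :=
      (Commute.one_right _).sub_right (commute_leftOp_rowOp _ _)
    beta_reduce
    rw [NNReal.smul_def, map_smul, lmul_smul, h2, ← leftOp_apply, ← Module.End.mul_apply, hc.eq,
      Module.End.mul_apply, leftOp_apply, h, map_zero, smul_zero]
  -- The limit space contains the columns of `X1`, hence those of `X1p`, because `X1` is `X1p` times
  -- an invertible matrix.
  have hAX : A0 * A0ᵀ * D.X1p = D.X1p := by
    have h1 : (1 - TTCone.proj A0) * D.X1 = 0 := by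
      rw [← D.lUnf_mul_row, ← Matrix.mul_assoc, ← lUnf_lmul, hX0]
      exact Matrix.zero_mul _
    have h2 : (1 - TTCone.proj A0) * D.X1p = 0 := by
      rw [← D.X1_eq, ← Matrix.mul_assoc] at h1
      have := congrArg (· * (D.X1pᵀ * D.X1)⁻¹) h1
      simpa [Matrix.mul_assoc, Matrix.mul_nonsing_inv _
        ((Matrix.isUnit_iff_isUnit_det _).1 (D.isUnit_left hX))] using this
    rw [Matrix.sub_mul, Matrix.one_mul] at h2
    exact (sub_eq_zero.1 h2).symm
  obtain ⟨U1, hU, hXU, hsum⟩ := D.orth_X1p.exists_sub hA0 hAX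
  refine ⟨U1, hU, ?_, ?_⟩
  · rw [← Matrix.transpose_transpose D.X1p, ← Matrix.transpose_mul, hXU, Matrix.transpose_zero]
  · have h1 : leftOp (1 - TTCone.proj A0)
        = (1 : Module.End ℝ (Tensor n1 n2 n3)) - D.P - leftOp (TTCone.proj U1) := by
      refine LinearMap.ext fun T => lUnf_injective ?_
      simp [OrthTT.P, leftOp, TTCone.proj, hsum, Matrix.sub_mul, Matrix.add_mul, sub_sub]
    rw [← h1]
    exact hZ0

theorem OrthTT.exists_right_of_mem_tangentCone (D : OrthTT X r1 r2) (hX : IsTTRank X r1 r2)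
    (hk2 : k2 ≤ n3) {Z : Tensor n1 n2 n3} (hZ : Z ∈ tangentCone k1 k2 X) :
    ∃ V3 : Matrix (Fin (k2 - r2)) (Fin n3) ℝ, IsStiefel V3ᵀ ∧ V3 * D.X3ppᵀ = 0 ∧
      ((1 - D.Q - rightOp (TTCone.proj V3ᵀ) : Module.End ℝ (Tensor n1 n2 n3)) * (1 - D.K)) Z = 0 := by
  obtain ⟨α, l, hl, c, d, hd, hmem, hcd⟩ := exists_fun_of_mem_tangentConeAt hZ
  have hex : ∀ n, ∃ A : Matrix (Fin n3) (Fin k2) ℝ, X + d n ∈ boundedTT n1 n2 n3 k1 k2 →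
      IsStiefel A ∧ rmul (X + d n) (TTCone.proj A) = X + d n := by
    intro n
    by_cases h : X + d n ∈ boundedTT n1 n2 n3 k1 k2
    · obtain ⟨q1, q2, hq, -, hq2⟩ := id h
      obtain ⟨A, hA⟩ := exists_isStiefel_rmul_eq hq.1 hq2 hk2
      exact ⟨A, fun _ => hA⟩
    · exact ⟨0, fun h' => absurd h' h⟩
  choose A hA using hex
  obtain ⟨f, A0, hfne, hf, hA0, hproj⟩ := exists_tendsto_proj (hmem.mono fun n hn => (hA n hn).1)
  have hmem' := hmem.filter_mono hf
  have hzero : ∀ᶠ n in f, rmul (X + d n) (1 - TTCone.proj (A n)) = 0 := by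
    filter_upwards [hmem'] with n hn
    rw [← rightOp_apply, rightOp_one_sub, LinearMap.sub_apply, rightOp_apply, (hA n hn).2]
    exact sub_self _
  have hX0 : rmul X (1 - TTCone.proj A0) = 0 := by
    have h1 : Tendsto (fun n => rmul (X + d n) (1 - TTCone.proj (A n))) f
        (𝓝 (rmul X (1 - TTCone.proj A0))) := by
      refine tendsto_rmul ?_ hproj
      simpa using tendsto_const_nhds.add (hd.mono_left hf)
    exact tendsto_nhds_unique h1 (tendsto_const_nhds.congr' (hzero.mono fun _ h => h.symm))
  have hZ0 : rmul ((1 - D.K) Z) (1 - TTCone.proj A0) = 0 := by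
    have h1 : Tendsto (fun n => rmul ((1 - D.K) (c n • d n)) (1 - TTCone.proj (A n))) f
        (𝓝 (rmul ((1 - D.K) Z) (1 - TTCone.proj A0))) := by
      refine tendsto_rmul ?_ hproj
      exact ((LinearMap.continuous_of_finiteDimensional (1 - D.K)).tendsto Z).comp
        (hcd.mono_left hf)
    refine tendsto_nhds_unique h1 (tendsto_const_nhds.congr' (hzero.mono fun n h => ?_))
    have h2 : (1 - D.K) (d n) = (1 - D.K) (X + d n) := by
      rw [map_add, D.one_sub_K_X, zero_add]
    have hc : Commute (rightOp (1 - TTCone.proj (A n))) (1 - D.K) :=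
      (Commute.one_right _).sub_right (commute_rightOp_colOp _ _)
    beta_reduce
    rw [NNReal.smul_def, map_smul, smul_rmul, h2, ← rightOp_apply, ← Module.End.mul_apply, hc.eq,
      Module.End.mul_apply, rightOp_apply, h, map_zero, smul_zero]
  -- The mirror argument: `X3` is an invertible matrix times `X3pp`.
  have hAX : A0 * A0ᵀ * D.X3ppᵀ = D.X3ppᵀ := by
    have h1 : D.X3 * (1 - TTCone.proj A0) = 0 := by
      rw [← D.col_mul_rUnf, Matrix.mul_assoc, ← rUnf_rmul, hX0]
      exact Matrix.mul_zero _
    have h2 : D.X3pp * (1 - TTCone.proj A0) = 0 := by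
      rw [← D.X3_eq, Matrix.mul_assoc] at h1
      have := congrArg ((D.X3 * D.X3ppᵀ)⁻¹ * ·) h1
      simpa [← Matrix.mul_assoc, Matrix.nonsing_inv_mul _
        ((Matrix.isUnit_iff_isUnit_det _).1 (D.isUnit_right hX))] using this
    rw [Matrix.mul_sub, Matrix.mul_one] at h2
    change TTCone.proj A0 * D.X3ppᵀ = D.X3ppᵀ
    rw [← transpose_proj, ← Matrix.transpose_mul, ← sub_eq_zero.1 h2]
  obtain ⟨V, hV, hXV, hsum⟩ := D.orth_X3pp.exists_sub hA0 hAX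
  refine ⟨Vᵀ, hV, ?_, ?_⟩
  · rw [← Matrix.transpose_mul]
    rw [Matrix.transpose_transpose] at hXV
    rw [hXV, Matrix.transpose_zero]
  · have h1 : rightOp (1 - TTCone.proj A0)
        = (1 : Module.End ℝ (Tensor n1 n2 n3)) - D.Q - rightOp (TTCone.proj Vᵀᵀ) := by
      refine LinearMap.ext fun T => rUnf_injective ?_
      simp [OrthTT.Q, rightOp, TTCone.proj, hsum, Matrix.mul_sub, Matrix.mul_add, sub_sub]
    rw [← h1]
    exact hZ0

/-! ## Metric projections onto cones -/

/-- A best approximation in a cone is also best on its own ray; convexity of the cone plays no role.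
-/
theorem inner_eq_of_mem_metricProj {E : Type*} [NormedAddCommGroup E] [InnerProductSpace ℝ E]
    {C : Set E} (hC : ∀ z ∈ C, ∀ t : ℝ, 0 ≤ t → t • z ∈ C) {y z : E} (hz : z ∈ metricProj C y) :
    inner ℝ y z = ‖z‖ ^ 2 := by
  have key : ∀ t : ℝ, 0 ≤ t →
      ‖z‖ ^ 2 - 2 * inner ℝ y z ≤ t ^ 2 * ‖z‖ ^ 2 - 2 * (t * inner ℝ y z) := by
    intro t ht
    have := hz.2 _ (hC z hz.1 t ht)
    rw [norm_sub_sq_real, norm_sub_sq_real, inner_smul_left, norm_smul, mul_pow, Real.norm_eq_abs,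
      sq_abs, real_inner_comm, conj_trivial] at this
    linarith
  rcases eq_or_ne z 0 with rfl | hz0
  · simp
  have ha : 0 < ‖z‖ ^ 2 := by positivity
  have hb : 0 ≤ inner ℝ y z := by
    have := key 0 le_rfl
    nlinarith
  -- This is the minimizer of the quadratic in `t`; it is admissible by the comparison with `t = 0`
  -- that gives `hb`.
  have h := key (inner ℝ y z / ‖z‖ ^ 2) (div_nonneg hb ha.le)
  set a := ‖z‖ ^ 2
  set b := inner ℝ y z
  have h' : (b / a) ^ 2 * a - 2 * (b / a * b) = -(b ^ 2) / a := by
    field_simp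
    ring
  rw [h', le_div_iff₀ ha] at h
  nlinarith [sq_nonneg (b - a)]

theorem metricProj_nonempty {E : Type*} [NormedAddCommGroup E] [ProperSpace E] {C : Set E}
    (hC : IsClosed C) (hne : C.Nonempty) (y : E) : (metricProj C y).Nonempty := by
  obtain ⟨z, hz, hdist⟩ := hC.exists_infDist_eq_dist hne y
  refine ⟨z, hz, fun w hw => ?_⟩
  have := Metric.infDist_le_dist_of_mem (x := y) hw
  rw [hdist, dist_comm y z, dist_comm y w, dist_eq_norm, dist_eq_norm] at this
  gcongr

/-! ## The approximation property -/

theorem omega_eq_sqrt_ratio (hr1 : r1 ≤ k1) (hr2 : r2 ≤ k2) :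
    omega n1 n3 r1 r2 k1 k2 = √(ratio n1 n3 r1 r2 (k1 - r1) (k2 - r2)) := by
  rw [omega, ratio, Nat.cast_sub hr1, Nat.cast_sub hr2]

theorem ratio_pos (hr1 : r1 ≤ k1) (hr2 : r2 ≤ k2) (hk1 : k1 ≤ n1) (hk2 : k2 ≤ n3)
    (hne : (r1, r2) ≠ (k1, k2)) : 0 < ratio n1 n3 r1 r2 (k1 - r1) (k2 - r2) := by
  rw [ratio, lt_max_iff]
  have aux : ∀ {r k n : ℕ}, r < k → k ≤ n → 0 < ((k - r : ℕ) : ℝ) / ((n : ℝ) - r) := by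
    intro r k n hrk hkn
    refine div_pos (by exact_mod_cast Nat.sub_pos_of_lt hrk) (sub_pos.2 ?_)
    exact_mod_cast hrk.trans_le hkn
  rcases hr1.lt_or_eq with h | h
  · exact Or.inl (aux h hk1)
  · exact Or.inr (aux (lt_of_le_of_ne hr2 fun h' => hne (by rw [h, h'])) hk2)

theorem ratio_le_one (hr1 : r1 ≤ k1) (hr2 : r2 ≤ k2) (hk1 : k1 ≤ n1) (hk2 : k2 ≤ n3) :
    ratio n1 n3 r1 r2 (k1 - r1) (k2 - r2) ≤ 1 :=
  max_le (div_sub_le_one (Nat.sub_le_sub_right hk1 _) (hr1.trans hk1))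
    (div_sub_le_one (Nat.sub_le_sub_right hk2 _) (hr2.trans hk2))

/-- The metric projection lies in the range of one of the projectors, so it is no longer than the
image of `Y` under it. That image and the computed tensor differ in squared norm only through the
gain. -/
theorem OrthTT.IsGood.mul_norm_sq_le (D : OrthTT X r1 r2) (hX : IsTTRank X r1 r2)
    (hk1 : k1 ≤ n1) (hk2 : k2 ≤ n3) {Y Yh : Tensor n1 n2 n3} {c : ℝ} (hc : c ≤ 1)
    {U1 : Matrix (Fin n1) (Fin (k1 - r1)) ℝ} {V3 : Matrix (Fin (k2 - r2)) (Fin n3) ℝ}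
    (hg : D.IsGood Y c U1 V3) (hc0 : 0 ≤ c) (hYh : Yh ∈ metricProj (tangentCone k1 k2 X) Y) :
    c * ‖Yh‖ ^ 2 ≤ ‖assemble D Y U1 V3‖ ^ 2 := by
  obtain ⟨U, hU, hUX, hUZ⟩ := D.exists_left_of_mem_tangentCone hX hk1 hYh.1
  obtain ⟨V, hV, hVX, hVZ⟩ := D.exists_right_of_mem_tangentCone hX hk2 hYh.1
  have hp : D.IsParam U V := ⟨hU, hUX, hV, hVX⟩
  have hle := norm_le_norm_frameProj D.isFrame hp.admU hp.admV (commute_leftOp_rightOp _ _) hUZ hVZ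
    (inner_eq_of_mem_metricProj (fun z hz t ht => smul_mem_tangentCone hz ht) hYh)
  have hle2 : ‖Yh‖ ^ 2 ≤ _ := pow_le_pow_left₀ (norm_nonneg _) hle 2
  rw [norm_sq_frameProj D.isFrame hp.admU hp.admV (commute_leftOp_rightOp _ _)] at hle2
  rw [D.assemble_eq, norm_sq_frameProj D.isFrame hg.admU hg.admV (commute_leftOp_rightOp _ _)]
  have h1 := hg.mul_gain_le U V hp
  unfold OrthTT.gain at h1
  -- The terms independent of `U1` and `V3` are common to both sides, so they only need `c ≤ 1`.
  have h2 : c * (‖((1 - D.P) * D.R) Y‖ ^ 2 + ‖(D.K * (1 - D.Q)) Y‖ ^ 2 + ‖(D.P * D.Q) Y‖ ^ 2)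
      ≤ ‖((1 - D.P) * D.R) Y‖ ^ 2 + ‖(D.K * (1 - D.Q)) Y‖ ^ 2 + ‖(D.P * D.Q) Y‖ ^ 2 :=
    mul_le_of_le_one_left (by positivity) hc
  have h3 := mul_le_mul_of_nonneg_left hle2 hc0
  rw [mul_add] at h3
  linarith

theorem OrthTT.IsParam.inner_assemble {s1 s2 : ℕ} {D : OrthTT X r1 r2}
    {U1 : Matrix (Fin n1) (Fin s1) ℝ} {V3 : Matrix (Fin s2) (Fin n3) ℝ} (h : D.IsParam U1 V3)
    (Y : Tensor n1 n2 n3) : inner ℝ Y (assemble D Y U1 V3) = ‖assemble D Y U1 V3‖ ^ 2 := by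
  rw [D.assemble_eq]
  exact (frameProj_isOrthProj D.isFrame h.admU h.admV (commute_leftOp_rightOp _ _)).inner_self Y

end Variety

end TTCone

end

theorem mainTheorem1 {n1 n2 n3 r1 r2 k1 k2 : ℕ}
    (hr1 : r1 ≤ k1) (hr2 : r2 ≤ k2) (hk1 : k1 ≤ n1) (hk2 : k2 ≤ n3)
    (hne : (r1, r2) ≠ (k1, k2))
    (X : TTCone.Tensor n1 n2 n3) (hX : TTCone.IsTTRank X r1 r2)
    (D : TTCone.OrthTT X r1 r2)
    (ε : ℝ) (hε : 0 < ε) (imax : ℕ) (himax : 0 < imax) :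
    0 < TTCone.omega n1 n3 r1 r2 k1 k2 ∧ TTCone.omega n1 n3 r1 r2 k1 k2 ≤ 1 ∧
    ∀ Y : TTCone.Tensor n1 n2 n3,
      (TTCone.metricProj (TTCone.tangentCone k1 k2 X) Y).Nonempty ∧
      (k1 - r1 ≤ n2 * n3 → k2 - r2 ≤ n1 * n2 →
        (TTCone.approxProj k1 k2 ε imax D Y).Nonempty) ∧
      ∀ Yt ∈ TTCone.approxProj k1 k2 ε imax D Y,
        Yt ∈ TTCone.tangentCone k1 k2 X ∧
        ∀ Yh ∈ TTCone.metricProj (TTCone.tangentCone k1 k2 X) Y,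
          TTCone.omega n1 n3 r1 r2 k1 k2 * ‖Yh‖ * ‖Yt‖ ≤ inner ℝ Y Yt := by
  have hpos := TTCone.ratio_pos hr1 hr2 hk1 hk2 hne
  have hle := TTCone.ratio_le_one (n1 := n1) (n3 := n3) hr1 hr2 hk1 hk2
  have hs1 : k1 - r1 ≤ n1 - r1 := Nat.sub_le_sub_right hk1 _
  have hs2 : k2 - r2 ≤ n3 - r2 := Nat.sub_le_sub_right hk2 _
  rw [TTCone.omega_eq_sqrt_ratio hr1 hr2]
  refine ⟨Real.sqrt_pos.2 hpos, Real.sqrt_le_one.2 hle, fun Y => ⟨?_, fun h1 h2 => ?_, ?_⟩⟩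
  · exact TTCone.metricProj_nonempty TTCone.isClosed_tangentCone
      ⟨0, TTCone.zero_mem_tangentCone X ⟨r1, r2, hX, hr1, hr2⟩⟩ Y
  · obtain ⟨U1, V3, h⟩ := TTCone.exists_isAlgOutput (ε := ε) D Y himax hs1 h1 hs2 h2
    exact ⟨_, U1, V3, h, rfl⟩
  · rintro _ ⟨U1, V3, hout, rfl⟩
    have hg := hout.isGood himax hs1 (hr1.trans hk1) hs2 (hr2.trans hk2)
    refine ⟨D.assemble_mem_tangentCone hX Y U1 V3 (by omega) (by omega), fun Yh hYh => ?_⟩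
    -- The inner product is the squared norm of the computed tensor; cancelling one factor leaves `ω
    -- ‖Yh‖ ≤ ‖Yt‖`, which is proved in squared form.
    rw [hg.toIsParam.inner_assemble, sq]
    refine mul_le_mul_of_nonneg_right ?_ (norm_nonneg _)
    have h := hg.mul_norm_sq_le D hX hk1 hk2 hle hpos.le hYh
    refine abs_le_of_sq_le_sq' ?_ (norm_nonneg _) |>.2
    rwa [mul_pow, Real.sq_sqrt hpos.le]
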